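/- **Setting.** Fix $n$ (the number of nodes), a depth $l\ge 2$ and widths $h_0,\dots,h_l\le h$, where $K=h_l\ge 2$ is the number of classes. A graph is a pair $G=(X,A)$ with $X\in\mathcal X\subseteq\mathbb R^{n\times h_0}$ and an adjacency matrix $A\in\mathcal G\subseteq\mathbb R^{n\times n}$, and $P_G\in\mathbb R^{n\times n}$ is a matrix determined by $A$, with $\|P_G\|_2$ bounded over $A\in\mathcal G$. The $l$-layer MPGNN with parameters $w=(W_1,\dots,W_l,U_1,\dots,U_{l-1})$, $W_k\in\mathbb R^{h_{k-1}\times h_k}$, $U_k\in\mathbb R^{h_0\times h_k}$, is $$H_0=0,\quad H_k=\phi_k\big(XU_k+\rho_k(P_G\,\psi_k(H_{k-1})W_k)\big)\ (1\le k\le l-1),\quad f_w(G)=\tfrac1n\mathbf 1_nH_{l-1}W_l\in\mathbb R^{1\times K},$$ where $\phi_k,\rho_k,\psi_k$ act entrywise and $\mathbf 1_n$ is the all-ones row vector. For $\epsilon>0$ the $\epsilon$-attack may replace $G=(X,A)$ by any $G'=(X',A')$ with $\|X'-X\|_2\le\epsilon$ and $A'\in\mathcal G$. The robust margin of $(G,y)$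 is $RM_w(G,y)=\inf_{G'}\big(f_w(G')_y-\max_{j\ne y}f_w(G')_j\big)$, the infimum being over all such $G'$. For a distribution $\mathcal D$ of samples $(G,y)$ with $G\in\mathcal X\times\mathcal G$ and a training set $S$ of $m\ge1$ samples, let $R_\gamma(f_w)=\mathbb P_{(G,y)\sim\mathcal D}\{RM_w(G,y)\le\gamma\}$ and $\hat R_\gamma(f_w)=\frac1m\sum_{(G,y)\in S}\mathbb 1\{RM_w(G,y)\le\gamma\}$. **Assumptions.** $\|X\|_2\le B$ for all $X\in\mathcal X$; $\phi_k,\rho_k,\psi_k$ are $L$-Lipschitz and vanish at $0$; and the parameters satisfy $\|W_k\|_2\le M_2$ for $1\le k\le l$ and $\|U_k\|_2\le M_1$ for $1\le k\le l-1$. Here $\|\cdot\|_2$ is the spectral and $\|\cdot\|_F$ the Frobenius norm. **Notation.** $p=\sup_{A\in\mathcal G}\|P_G\|_2$, $\tau=L^3M_2\,p$, $\xi=LM_1M_2\frac{\tau^{l-1}-1}{\tau-1}$ (for $\tau\ne1$), $\zeta=\min\big(\{\|W_k\|_2\}_{k=1}^{l},\{\|U_k\|_2\}_{k=1}^{l-1}\big)$,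 $|w|_2^2=\sum_{k=1}^l\|W_k\|_F^2+\sum_{k=1}^{l-1}\|U_k\|_F^2$, $\Psi_0=(B+\epsilon)^2h\log(lh)$, $$\Psi_1(f_w)=\max\{\zeta^{-6},(LM_1M_2)^3\}\,|w|_2^2,\qquad \Psi_2(f_w)=\max\{\zeta^{-1},\xi^{1/l}\}^{2l+2}\,|w|_2^2 .$$ **Theorem.** There is an absolute constant $C>0$ such that, in every setting as above and for all $\epsilon,\gamma,\delta>0$, with probability at least $1-\delta$ over the choice of $S$ ($m$ independent samples from $\mathcal D$), the following holds simultaneously for all $w$ that satisfy the norm bounds and have $\zeta>0$. If $\tau=1$, then $$R_0(f_w)\le\hat R_\gamma(f_w)+C\sqrt{\frac{(l+1)^4\,\Psi_0\Psi_1(f_w)+\max\{1,\gamma^2\}\log(m/\delta)}{\gamma^2m}},$$ and if $\tau\ne1$, then $$R_0(f_w)\le\hat R_\gamma(f_w)+C\sqrt{\frac{l^2\,\Psi_0\Psi_2(f_w)+\max\{1,\gamma^2\}\log(m(l+1)/\delta)}{\gamma^2m}}.$$ (For $\gamma\le1$ the factor $\max\{1,\gamma^2\}$ is $1$.) Moreover,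 for $\tau\ne1$ the main term scales in $p$, $l$ and $h$ as follows: $$\sqrt{l^2\Psi_0\Psi_2(f_w)}\le c_w\cdot\max\{1,p\}^{(l-2)(l+1)/l}\;l\,\sqrt{h\log(lh)},$$ where $c_w=(B+\epsilon)\,|w|_2\,\max\big\{\zeta^{-1},\big((l-1)LM_1M_2\max\{1,L^3M_2\}^{l-2}\big)^{1/l}\big\}^{l+1}$ does not involve $p$. -/

import Mathlib

open MeasureTheory
open scoped NNReal

noncomputable section

namespace MPGNN

/-- The spectral norm `‖M‖₂`: the operator norm of `M` between Euclidean spaces. -/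
def specNorm {a b : ℕ} (M : Matrix (Fin a) (Fin b) ℝ) : ℝ :=
  ‖(Matrix.toEuclideanLin M).toContinuousLinearMap‖

/-- The squared Frobenius norm `‖M‖_F²`. -/
def frobSq {a b : ℕ} (M : Matrix (Fin a) (Fin b) ℝ) : ℝ :=
  ∑ i, ∑ j, M i j ^ 2

/-- Matrices carry the product (Borel) σ-algebra of their entries. -/
instance instMeasurableSpaceMatrix (a b : ℕ) : MeasurableSpace (Matrix (Fin a) (Fin b) ℝ) :=
  inferInstanceAs (MeasurableSpace (Fin a → Fin b → ℝ))

/-- A graph on `n` nodes, `G = (X, A)`: feature matrix `X` (`h₀` features for each node) and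
adjacency matrix `A`. -/
abbrev Graph (n h₀ : ℕ) : Type :=
  Matrix (Fin n) (Fin h₀) ℝ × Matrix (Fin n) (Fin n) ℝ

/-- A labelled sample `z = (G, y)` with one of `K` labels. -/
abbrev Sample (n h₀ K : ℕ) : Type := Graph n h₀ × Fin K

/-- The parameters of a network with `r` message-passing layers and a readout layer, that is with
`l = r + 1` layers, and with widths `d 0, …, d (r + 1)`. The matrix `W k` here is `W_{k+1}` in
one-based numbering, and likewise for `U`. -/
structure Weights (r : ℕ) (d : ℕ → ℕ) where
  W : (k : Fin (r + 1)) → Matrix (Fin (d k)) (Fin (d (k + 1))) ℝ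
  U : (k : Fin r) → Matrix (Fin (d 0)) (Fin (d (k + 1))) ℝ

/-- The scalar functions that are applied entrywise in each of the `r` message-passing layers. -/
structure Activations (r : ℕ) where
  φ : Fin r → ℝ → ℝ
  ρ : Fin r → ℝ → ℝ
  ψ : Fin r → ℝ → ℝ

/-- All activations are `L`-Lipschitz and centred at zero. -/
structure Activations.Admissible {r : ℕ} (act : Activations r) (L : ℝ≥0) : Prop where
  lip_φ : ∀ k, LipschitzWith L (act.φ k)
  lip_ρ : ∀ k, LipschitzWith L (act.ρ k)
  lip_ψ : ∀ k, LipschitzWith L (act.ψ k)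
  zero_φ : ∀ k, act.φ k 0 = 0
  zero_ρ : ∀ k, act.ρ k 0 = 0
  zero_ψ : ∀ k, act.ψ k 0 = 0

section Network

variable {n r : ℕ} {d : ℕ → ℕ}

/-- The node representations: `H_0 = 0` and
`H_{k+1} = φ (X U_{k+1} + ρ (P_G ψ(H_k) W_{k+1}))` for `k < r`. The argument `PG` is the matrix
`P_G` of the graph. -/
def hidden (act : Activations r) (w : Weights r d)
    (X : Matrix (Fin n) (Fin (d 0)) ℝ) (PG : Matrix (Fin n) (Fin n) ℝ) :
    (k : ℕ) → k ≤ r → Matrix (Fin n) (Fin (d k)) ℝ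
  | 0, _ => 0
  | k + 1, hk =>
    (X * w.U ⟨k, hk⟩ +
      (PG * (hidden act w X PG k (Nat.le_of_succ_le hk)).map (act.ψ ⟨k, hk⟩) *
        w.W ⟨k, Nat.lt_succ_of_lt hk⟩).map (act.ρ ⟨k, hk⟩)).map (act.φ ⟨k, hk⟩)

/-- The output `f_w(G) = (1/n) 1_n H_{l-1} W_l`, where `1_n` is the all-ones row vector. The matrix
`P_G` is the value `P A` at the adjacency matrix of the graph. -/
def output (P : Matrix (Fin n) (Fin n) ℝ → Matrix (Fin n) (Fin n) ℝ)
    (act : Activations r) (w : Weights r d) (G : Graph n (d 0)) : Fin (d (r + 1)) → ℝ :=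
  (1 / (n : ℝ)) • Matrix.vecMul (fun _ => 1)
    (hidden act w G.1 (P G.2) r le_rfl * w.W ⟨r, Nat.lt_succ_self r⟩)

/-- The margin `v_y - max_{j ≠ y} v_j` of a score vector. -/
def margin {K : ℕ} (v : Fin K → ℝ) (y : Fin K) : ℝ :=
  v y - ⨆ j : {j : Fin K // j ≠ y}, v j

/-- The `ε`-attack on `G = (X, A)`: the features may be moved by at most `ε` in spectral norm, and
the adjacency matrix may be replaced by any admissible one. -/
def attack {h₀ : ℕ} (ε : ℝ) (𝒢 : Set (Matrix (Fin n) (Fin n) ℝ)) (G : Graph n h₀) :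
    Set (Graph n h₀) :=
  {G' | specNorm (G'.1 - G.1) ≤ ε ∧ G'.2 ∈ 𝒢}

/-- The robust margin: the infimum of the margin over all attacked versions of the graph. -/
def robustMargin (ε : ℝ) (𝒢 : Set (Matrix (Fin n) (Fin n) ℝ))
    (P : Matrix (Fin n) (Fin n) ℝ → Matrix (Fin n) (Fin n) ℝ)
    (act : Activations r) (w : Weights r d) (z : Sample n (d 0) (d (r + 1))) : ℝ :=
  ⨅ G' : attack ε 𝒢 z.1, margin (output P act w G'.1) z.2

/-- The expected robust margin loss `R_γ(f_w)`. -/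
def robustLoss (ε : ℝ) (𝒢 : Set (Matrix (Fin n) (Fin n) ℝ))
    (P : Matrix (Fin n) (Fin n) ℝ → Matrix (Fin n) (Fin n) ℝ)
    (act : Activations r) (D : Measure (Sample n (d 0) (d (r + 1)))) (γ : ℝ)
    (w : Weights r d) : ℝ :=
  D.real {z | robustMargin ε 𝒢 P act w z ≤ γ}

open Classical in
/-- The empirical robust margin loss over the training set `S`. -/
def empRobustLoss (ε : ℝ) (𝒢 : Set (Matrix (Fin n) (Fin n) ℝ))
    (P : Matrix (Fin n) (Fin n) ℝ → Matrix (Fin n) (Fin n) ℝ)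
    (act : Activations r) {m : ℕ} (S : Fin m → Sample n (d 0) (d (r + 1))) (γ : ℝ)
    (w : Weights r d) : ℝ :=
  (1 / (m : ℝ)) * ∑ i, if robustMargin ε 𝒢 P act w (S i) ≤ γ then 1 else 0

/-- The uniform bounds `‖W_k‖₂ ≤ M₂` and `‖U_k‖₂ ≤ M₁`. -/
def Weights.Bounded (w : Weights r d) (M₁ M₂ : ℝ) : Prop :=
  (∀ k, specNorm (w.W k) ≤ M₂) ∧ ∀ k, specNorm (w.U k) ≤ M₁

/-- `ζ`, the smallest spectral norm among all weight matrices. -/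
def zeta (w : Weights r d) : ℝ :=
  min (⨅ k, specNorm (w.W k)) (⨅ k, specNorm (w.U k))

/-- `|w|₂²`, the sum of the squares of all parameters. -/
def normSq (w : Weights r d) : ℝ :=
  ∑ k, frobSq (w.W k) + ∑ k, frobSq (w.U k)

/-- The largest spectral norm of the matrices `P_G` over the admissible graphs. -/
def maxSpec (𝒢 : Set (Matrix (Fin n) (Fin n) ℝ))
    (P : Matrix (Fin n) (Fin n) ℝ → Matrix (Fin n) (Fin n) ℝ) : ℝ :=
  ⨆ A : 𝒢, specNorm (P A)

/-- `Ψ₁(f_w) = max {ζ⁻⁶, (L M₁ M₂)³} |w|₂²`. -/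
def Psi1 (L M₁ M₂ : ℝ) (w : Weights r d) : ℝ :=
  max ((zeta w)⁻¹ ^ 6) ((L * M₁ * M₂) ^ 3) * normSq w

/-- `Ψ₂(f_w) = max {ζ⁻¹, ξ^{1/l}}^{2l+2} |w|₂²` with `l = r + 1`. -/
def Psi2 (ξ : ℝ) (w : Weights r d) : ℝ :=
  max (zeta w)⁻¹ (ξ ^ (1 / ((r + 1 : ℕ) : ℝ))) ^ (2 * (r + 1) + 2) * normSq w

end Network

/-- `τ = L³ M₂ p`, where `p` is the largest spectral norm of the matrices `P_G`. -/
def tau (L M₂ p : ℝ) : ℝ := L ^ 3 * M₂ * p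

/-- `ξ = L M₁ M₂ (τ^{l-1} - 1) / (τ - 1)`, used for `τ ≠ 1`. -/
def xi (l : ℕ) (L M₁ M₂ τ : ℝ) : ℝ :=
  L * M₁ * M₂ * ((τ ^ (l - 1) - 1) / (τ - 1))

/-- `Ψ₀ = (B + ε)² h log (l h)`. -/
def Psi0 (l h : ℕ) (B ε : ℝ) : ℝ :=
  (B + ε) ^ 2 * h * Real.log (l * h)

end MPGNN

end

open MPGNN

/-! The proof is a covering argument. The robust margin is Lipschitz in the weights: if all matrices
of `w` and `v` differ by at most `t` in spectral norm, the margins differ by at most `2 t T`, where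
`T = L (M₂ + l M₁) (1 + τ + ⋯ + τ^(l-2)) (B + ε)` (`robustMargin_le_add_of_weights`). For `2 t T = γ
/ 2` the error of `w` at margin `0` is at most that of `v` at margin `γ / 2`, and the empirical
error of `v` at margin `γ / 2` is at most that of `w` at margin `γ`. Hence it suffices to control
the deviations of the networks in a `t`-net.

The size of the net comes from the dual Sudakov inequality. A Gaussian weight vector has all its
matrices of spectral norm at most `t₀`, with `t₀²` of order `h log (l h)`, with probability at least
one half. Translating this symmetric set by `w` costs at most a factor `exp (-|w|₂² / 2)` of
Gaussian mass, so only `2 exp (R / 2)` disjoint translates have centres with `|w|₂² ≤ R`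
(`card_le_of_disjoint_translates`, `exists_weights_net`). The logarithm of the net size is thus of
order `|w|₂² t₀² / t²`, with no count of the parameters.

Hoeffding's inequality and a union bound over all nets and all integer budgets `k` for `|w|₂²`
(`exists_uniform_event`) give a bound uniform in `w`. The resolution depends on `M₁` and `M₂` but
not on `w`, so no grid over the weight norms is needed and the confidence term is only `log (1 /
δ)`. Since `ζ ≤ M₁` and `ζ ≤ M₂`, the factor `M₂ + l M₁` is at most `2 l M₁ M₂ / ζ`. This turns the
bound into `complexity`, which is dominated by the `Ψ₁` and `Ψ₂` terms. -/

noncomputable section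

namespace MPGNN

/-! ### Spectral and Frobenius norms. -/

section MatrixNorms

variable {a b c : ℕ}

lemma specNorm_nonneg (M : Matrix (Fin a) (Fin b) ℝ) : 0 ≤ specNorm M := norm_nonneg _

lemma specNorm_add_le (M N : Matrix (Fin a) (Fin b) ℝ) :
    specNorm (M + N) ≤ specNorm M + specNorm N := by
  unfold specNorm
  rw [map_add, map_add]
  exact norm_add_le _ _

lemma specNorm_smul (r : ℝ) (M : Matrix (Fin a) (Fin b) ℝ) :
    specNorm (r • M) = |r| * specNorm M := by
  unfold specNorm
  rw [map_smul, map_smul, norm_smul, Real.norm_eq_abs]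

lemma specNorm_neg (M : Matrix (Fin a) (Fin b) ℝ) : specNorm (-M) = specNorm M := by
  simpa using specNorm_smul (-1) M

lemma specNorm_zero : specNorm (0 : Matrix (Fin a) (Fin b) ℝ) = 0 := by
  simp [specNorm]

lemma specNorm_sub_le (M N : Matrix (Fin a) (Fin b) ℝ) :
    specNorm (M - N) ≤ specNorm M + specNorm N := by
  rw [sub_eq_add_neg, ← specNorm_neg N]
  exact specNorm_add_le _ _

lemma continuous_specNorm : Continuous (specNorm (a := a) (b := b)) := by
  unfold specNorm
  refine continuous_norm.comp ?_
  exact LinearMap.continuous_of_finiteDimensional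
    ((LinearMap.toContinuousLinearMap.toLinearMap).comp
      (Matrix.toEuclideanLin (𝕜 := ℝ) (m := Fin a) (n := Fin b)).toLinearMap)

lemma specNorm_transpose (M : Matrix (Fin a) (Fin b) ℝ) : specNorm M.transpose = specNorm M := by
  have h := Matrix.l2_opNorm_conjTranspose M
  rw [Matrix.conjTranspose_eq_transpose_of_trivial] at h
  exact h

lemma sum_mulVec_sq_le (M : Matrix (Fin a) (Fin b) ℝ) (x : Fin b → ℝ) :
    ∑ i, (M.mulVec x) i ^ 2 ≤ specNorm M ^ 2 * ∑ j, x j ^ 2 := by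
  have h := (Matrix.toEuclideanLin M).toContinuousLinearMap.le_opNorm (WithLp.toLp 2 x)
  have h2 := pow_le_pow_left₀ (norm_nonneg _) h 2
  rw [mul_pow, EuclideanSpace.real_norm_sq_eq, EuclideanSpace.real_norm_sq_eq] at h2
  exact h2

lemma frobSq_nonneg (M : Matrix (Fin a) (Fin b) ℝ) : 0 ≤ frobSq M :=
  Finset.sum_nonneg fun _ _ => Finset.sum_nonneg fun _ _ => sq_nonneg _

lemma frobSq_transpose (M : Matrix (Fin a) (Fin b) ℝ) : frobSq M.transpose = frobSq M := by
  unfold frobSq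
  rw [Finset.sum_comm]
  rfl

/-- The operator norm bound is applied to each column of `N`. -/
lemma frobSq_mul_le_left (M : Matrix (Fin a) (Fin b) ℝ) (N : Matrix (Fin b) (Fin c) ℝ) :
    frobSq (M * N) ≤ specNorm M ^ 2 * frobSq N := by
  rw [← frobSq_transpose, ← frobSq_transpose N]
  unfold frobSq
  rw [Finset.mul_sum]
  exact Finset.sum_le_sum fun j _ => sum_mulVec_sq_le M fun i => N i j

lemma frobSq_mul_le_right (M : Matrix (Fin a) (Fin b) ℝ) (N : Matrix (Fin b) (Fin c) ℝ) :
    frobSq (M * N) ≤ specNorm N ^ 2 * frobSq M := by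
  rw [← frobSq_transpose, Matrix.transpose_mul, ← frobSq_transpose M, ← specNorm_transpose N]
  exact frobSq_mul_le_left _ _

/-- The Frobenius norm. -/
def frob (M : Matrix (Fin a) (Fin b) ℝ) : ℝ := √(frobSq M)

lemma frob_nonneg (M : Matrix (Fin a) (Fin b) ℝ) : 0 ≤ frob M := Real.sqrt_nonneg _

lemma sq_frob (M : Matrix (Fin a) (Fin b) ℝ) : frob M ^ 2 = frobSq M :=
  Real.sq_sqrt (frobSq_nonneg M)

lemma frob_zero : frob (0 : Matrix (Fin a) (Fin b) ℝ) = 0 := by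
  simp [frob, frobSq]

lemma frob_eq_norm (M : Matrix (Fin a) (Fin b) ℝ) :
    frob M = ‖WithLp.toLp 2 (fun ij : Fin a × Fin b => M ij.1 ij.2)‖ := by
  rw [EuclideanSpace.norm_eq, frob, frobSq, Fintype.sum_prod_type]
  simp

lemma frob_add_le (M N : Matrix (Fin a) (Fin b) ℝ) : frob (M + N) ≤ frob M + frob N := by
  simp only [frob_eq_norm]
  exact norm_add_le (WithLp.toLp 2 fun ij : Fin a × Fin b => M ij.1 ij.2)
    (WithLp.toLp 2 fun ij : Fin a × Fin b => N ij.1 ij.2)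

lemma frob_le_of_frobSq_le {d e : ℕ} {M : Matrix (Fin a) (Fin b) ℝ}
    {N : Matrix (Fin d) (Fin e) ℝ} {s : ℝ} (hs : 0 ≤ s) (h : frobSq M ≤ s ^ 2 * frobSq N) :
    frob M ≤ s * frob N := by
  unfold frob
  rw [← Real.sqrt_sq hs, ← Real.sqrt_mul (sq_nonneg s)]
  exact Real.sqrt_le_sqrt h

lemma frob_mul_le_left (M : Matrix (Fin a) (Fin b) ℝ) (N : Matrix (Fin b) (Fin c) ℝ) :
    frob (M * N) ≤ specNorm M * frob N :=
  frob_le_of_frobSq_le (specNorm_nonneg _) (frobSq_mul_le_left M N)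

lemma frob_mul_le_right (M : Matrix (Fin a) (Fin b) ℝ) (N : Matrix (Fin b) (Fin c) ℝ) :
    frob (M * N) ≤ frob M * specNorm N := by
  rw [mul_comm]
  exact frob_le_of_frobSq_le (specNorm_nonneg _) (frobSq_mul_le_right M N)

/-- This is why hidden states are measured in Frobenius norm: it is a sum over entries, so entrywise
maps keep their Lipschitz constant. The weights can still be measured in spectral norm. -/
lemma frob_map_sub_map_le {L : ℝ≥0} {f : ℝ → ℝ} (hf : LipschitzWith L f)
    (M N : Matrix (Fin a) (Fin b) ℝ) : frob (M.map f - N.map f) ≤ L * frob (M - N) := by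
  refine frob_le_of_frobSq_le L.coe_nonneg ?_
  unfold frobSq
  simp only [Finset.mul_sum]
  refine Finset.sum_le_sum fun i _ => Finset.sum_le_sum fun j _ => ?_
  have h := hf.dist_le_mul (M i j) (N i j)
  rw [Real.dist_eq, Real.dist_eq] at h
  rw [← mul_pow]
  rw [sq_le_sq, abs_mul, abs_of_nonneg L.coe_nonneg]
  exact h

/-- Row `i` is the transpose applied to a basis vector, so each of the `a` rows has length at most
the spectral norm. -/
lemma frobSq_le_specNorm (M : Matrix (Fin a) (Fin b) ℝ) : frobSq M ≤ a * specNorm M ^ 2 := by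
  have h : ∀ i, ∑ j, M i j ^ 2 ≤ specNorm M ^ 2 := by
    intro i
    have h := sum_mulVec_sq_le M.transpose (Pi.single i 1)
    rw [specNorm_transpose, Matrix.mulVec_single_one] at h
    simpa [Pi.single_apply, Matrix.col_apply] using h
  calc frobSq M ≤ ∑ _i : Fin a, specNorm M ^ 2 := Finset.sum_le_sum fun i _ => h i
    _ = a * specNorm M ^ 2 := by simp

lemma frob_le_specNorm (M : Matrix (Fin a) (Fin b) ℝ) : frob M ≤ √a * specNorm M := by
  unfold frob
  rw [← Real.sqrt_sq (specNorm_nonneg M), ← Real.sqrt_mul (Nat.cast_nonneg a)]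
  exact Real.sqrt_le_sqrt (frobSq_le_specNorm M)

lemma specNorm_le_frob (M : Matrix (Fin a) (Fin b) ℝ) : specNorm M ≤ frob M := by
  refine ContinuousLinearMap.opNorm_le_bound _ (frob_nonneg M) fun x => ?_
  refine le_of_sq_le_sq ?_ (by have := frob_nonneg M; positivity)
  rw [mul_pow, EuclideanSpace.real_norm_sq_eq, EuclideanSpace.real_norm_sq_eq, sq_frob, frobSq,
    Finset.sum_mul]
  refine Finset.sum_le_sum fun i _ => ?_
  exact Finset.sum_mul_sq_le_sq_mul_sq Finset.univ (fun j => M i j) x.ofLp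

lemma abs_sum_col_le (M : Matrix (Fin a) (Fin b) ℝ) (j : Fin b) :
    |∑ i, M i j| ≤ √a * frob M := by
  refine abs_le_of_sq_le_sq ?_ (by have := frob_nonneg M; positivity)
  rw [mul_pow, Real.sq_sqrt (Nat.cast_nonneg a), sq_frob]
  calc (∑ i, M i j) ^ 2 ≤ a * ∑ i, M i j ^ 2 := by
        simpa using sq_sum_le_card_mul_sum_sq (s := Finset.univ) (f := fun i => M i j)
    _ ≤ a * frobSq M := by
        refine mul_le_mul_of_nonneg_left ?_ (Nat.cast_nonneg a)
        exact Finset.sum_le_sum fun i _ =>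
          Finset.single_le_sum (f := fun j => M i j ^ 2) (fun _ _ => sq_nonneg _)
            (Finset.mem_univ j)

end MatrixNorms

/-! ### Lipschitz bounds for the network in its features and its weights. -/

section Perturbation

variable {n : ℕ}

lemma frob_mul_sub_mul_le {a b c : ℕ} (X₁ X₂ : Matrix (Fin a) (Fin b) ℝ)
    (U₁ U₂ : Matrix (Fin b) (Fin c) ℝ) {M t : ℝ} (hU : specNorm U₁ ≤ M)
    (ht : specNorm (U₁ - U₂) ≤ t) :
    frob (X₁ * U₁ - X₂ * U₂) ≤ frob (X₁ - X₂) * M + frob X₂ * t := by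
  have h : X₁ * U₁ - X₂ * U₂ = (X₁ - X₂) * U₁ + X₂ * (U₁ - U₂) := by
    rw [Matrix.sub_mul, Matrix.mul_sub]; abel
  rw [h]
  refine (frob_add_le _ _).trans (add_le_add ?_ ?_)
  · exact (frob_mul_le_right _ _).trans (mul_le_mul_of_nonneg_left hU (frob_nonneg _))
  · exact (frob_mul_le_right _ _).trans (mul_le_mul_of_nonneg_left ht (frob_nonneg _))

lemma frob_layer_sub_le {d₀ d₁ d₂ : ℕ} {L : ℝ≥0} {φ ρ ψ : ℝ → ℝ} (hφ : LipschitzWith L φ)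
    (hρ : LipschitzWith L ρ) (hψ : LipschitzWith L ψ) (hψ0 : ψ 0 = 0)
    {M₁ M₂ p t : ℝ} (hM₂ : 0 ≤ M₂) (ht : 0 ≤ t) {PG : Matrix (Fin n) (Fin n) ℝ}
    (hP : specNorm PG ≤ p)
    (X₁ X₂ : Matrix (Fin n) (Fin d₀) ℝ) (H₁ H₂ : Matrix (Fin n) (Fin d₁) ℝ)
    {U₁ U₂ : Matrix (Fin d₀) (Fin d₂) ℝ} {W₁ W₂ : Matrix (Fin d₁) (Fin d₂) ℝ}
    (hU : specNorm U₁ ≤ M₁) (hW : specNorm W₁ ≤ M₂)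
    (hU' : specNorm (U₁ - U₂) ≤ t) (hW' : specNorm (W₁ - W₂) ≤ t) :
    frob ((X₁ * U₁ + (PG * H₁.map ψ * W₁).map ρ).map φ -
        (X₂ * U₂ + (PG * H₂.map ψ * W₂).map ρ).map φ) ≤
      L * (frob (X₁ - X₂) * M₁ + frob X₂ * t) +
        (L : ℝ) ^ 3 * p * (frob (H₁ - H₂) * M₂ + frob H₂ * t) := by
  have hp : 0 ≤ p := (specNorm_nonneg _).trans hP
  have hL : (0 : ℝ) ≤ L := L.coe_nonneg
  have hH₂ : frob (H₂.map ψ) ≤ L * frob H₂ := by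
    have h0 : (0 : Matrix (Fin n) (Fin d₁) ℝ).map ψ = 0 := by ext; simp [hψ0]
    simpa [h0] using frob_map_sub_map_le hψ H₂ 0
  have h1 : frob (PG * H₁.map ψ - PG * H₂.map ψ) ≤ p * (L * frob (H₁ - H₂)) := by
    rw [← Matrix.mul_sub]
    exact (frob_mul_le_left _ _).trans
      (mul_le_mul hP (frob_map_sub_map_le hψ _ _) (frob_nonneg _) hp)
  have h2 : frob (PG * H₂.map ψ) ≤ p * (L * frob H₂) :=
    (frob_mul_le_left _ _).trans (mul_le_mul hP hH₂ (frob_nonneg _) hp)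
  have h3 : frob (PG * H₁.map ψ * W₁ - PG * H₂.map ψ * W₂) ≤
      p * (L * frob (H₁ - H₂)) * M₂ + p * (L * frob H₂) * t :=
    (frob_mul_sub_mul_le _ _ _ _ hW hW').trans (by gcongr)
  refine (frob_map_sub_map_le hφ _ _).trans ?_
  rw [add_sub_add_comm]
  calc L * frob (X₁ * U₁ - X₂ * U₂ +
        ((PG * H₁.map ψ * W₁).map ρ - (PG * H₂.map ψ * W₂).map ρ))
      ≤ L * ((frob (X₁ - X₂) * M₁ + frob X₂ * t) +
        L * (p * (L * frob (H₁ - H₂)) * M₂ + p * (L * frob H₂) * t)) := by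
        refine mul_le_mul_of_nonneg_left ((frob_add_le _ _).trans (add_le_add ?_ ?_)) hL
        · exact frob_mul_sub_mul_le _ _ _ _ hU hU'
        · exact (frob_map_sub_map_le hρ _ _).trans (mul_le_mul_of_nonneg_left h3 hL)
    _ = _ := by ring

/-- The partial geometric sum `1 + τ + ⋯ + τ ^ (k - 1)`. -/
def geo (τ : ℝ) (k : ℕ) : ℝ := ∑ i ∈ Finset.range k, τ ^ i

lemma geo_succ (τ : ℝ) (k : ℕ) : geo τ (k + 1) = 1 + τ * geo τ k := by
  rw [geo, geom_sum_succ, add_comm, geo]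

lemma geo_nonneg {τ : ℝ} (hτ : 0 ≤ τ) (k : ℕ) : 0 ≤ geo τ k :=
  Finset.sum_nonneg fun _ _ => pow_nonneg hτ _

variable {r : ℕ} {d : ℕ → ℕ} {act : Activations r} {L : ℝ≥0} {M₁ M₂ p : ℝ}

lemma tau_nonneg (hM₂ : 0 ≤ M₂) (hp : 0 ≤ p) : 0 ≤ tau L M₂ p := by
  unfold tau; positivity

lemma frob_hidden_succ_sub_le (hact : act.Admissible L) (hM₂ : 0 ≤ M₂)
    {w v : Weights r d} (hw : w.Bounded M₁ M₂) {t : ℝ} (ht : 0 ≤ t)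
    (hW : ∀ k, specNorm (w.W k - v.W k) ≤ t) (hU : ∀ k, specNorm (w.U k - v.U k) ≤ t)
    {PG : Matrix (Fin n) (Fin n) ℝ} (hP : specNorm PG ≤ p)
    (X₁ X₂ : Matrix (Fin n) (Fin (d 0)) ℝ) (k : ℕ) (hk : k + 1 ≤ r) :
    frob (hidden act w X₁ PG (k + 1) hk - hidden act v X₂ PG (k + 1) hk) ≤
      L * (frob (X₁ - X₂) * M₁ + frob X₂ * t) +
        (L : ℝ) ^ 3 * p * (frob (hidden act w X₁ PG k (Nat.le_of_succ_le hk) -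
          hidden act v X₂ PG k (Nat.le_of_succ_le hk)) * M₂ +
            frob (hidden act v X₂ PG k (Nat.le_of_succ_le hk)) * t) := by
  have hφ := hact.lip_φ ⟨k, hk⟩
  have hρ := hact.lip_ρ ⟨k, hk⟩
  have hψ := hact.lip_ψ ⟨k, hk⟩
  have hψ0 := hact.zero_ψ ⟨k, hk⟩
  have h1 := hw.2 ⟨k, hk⟩
  have h2 := hw.1 ⟨k, Nat.lt_succ_of_lt hk⟩
  have h3 := hU ⟨k, hk⟩
  have h4 := hW ⟨k, Nat.lt_succ_of_lt hk⟩
  simp only [hidden]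
  generalize hidden act w X₁ PG k (Nat.le_of_succ_le hk) = H₁
  generalize hidden act v X₂ PG k (Nat.le_of_succ_le hk) = H₂
  exact frob_layer_sub_le (d₀ := d 0) (d₁ := d k) (d₂ := d (k + 1)) hφ hρ hψ hψ0 hM₂ ht hP
    X₁ X₂ H₁ H₂ h1 h2 h3 h4

lemma frob_hidden_sub_le (hact : act.Admissible L) (hM₂ : 0 ≤ M₂)
    {w : Weights r d} (hw : w.Bounded M₁ M₂) {PG : Matrix (Fin n) (Fin n) ℝ}
    (hP : specNorm PG ≤ p) (X₁ X₂ : Matrix (Fin n) (Fin (d 0)) ℝ) (k : ℕ) (hk : k ≤ r) :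
    frob (hidden act w X₁ PG k hk - hidden act w X₂ PG k hk) ≤
      L * M₁ * geo (tau L M₂ p) k * frob (X₁ - X₂) := by
  have hp : 0 ≤ p := (specNorm_nonneg _).trans hP
  induction k with
  | zero => simp [hidden, frob_zero, geo]
  | succ k ih =>
    have ih := ih (Nat.le_of_succ_le hk)
    refine (frob_hidden_succ_sub_le hact hM₂ hw le_rfl (v := w) (by simp [specNorm_zero])
      (by simp [specNorm_zero]) hP X₁ X₂ k hk).trans ?_
    rw [geo_succ]
    calc L * (frob (X₁ - X₂) * M₁ + frob X₂ * 0) + (L : ℝ) ^ 3 * p * (frob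
          (hidden act w X₁ PG k (Nat.le_of_succ_le hk) -
            hidden act w X₂ PG k (Nat.le_of_succ_le hk)) * M₂ +
            frob (hidden act w X₂ PG k (Nat.le_of_succ_le hk)) * 0)
        ≤ L * (frob (X₁ - X₂) * M₁ + frob X₂ * 0) + (L : ℝ) ^ 3 * p *
          (L * M₁ * geo (tau L M₂ p) k * frob (X₁ - X₂) * M₂ +
            frob (hidden act w X₂ PG k (Nat.le_of_succ_le hk)) * 0) := by gcongr
      _ = _ := by unfold tau; ring

lemma hidden_zero_features (hact : act.Admissible L) (w : Weights r d)
    (PG : Matrix (Fin n) (Fin n) ℝ) (k : ℕ) (hk : k ≤ r) : hidden act w 0 PG k hk = 0 := by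
  induction k with
  | zero => rfl
  | succ k ih =>
    have h : ∀ {a b : ℕ} (f : ℝ → ℝ), f 0 = 0 → (0 : Matrix (Fin a) (Fin b) ℝ).map f = 0 := by
      intro a b f hf; ext; simp [hf]
    simp only [hidden, ih]
    rw [h _ (hact.zero_ψ _), Matrix.mul_zero, Matrix.zero_mul, Matrix.zero_mul,
      h _ (hact.zero_ρ _), add_zero, h _ (hact.zero_φ _)]

lemma frob_hidden_le (hact : act.Admissible L) (hM₂ : 0 ≤ M₂)
    {w : Weights r d} (hw : w.Bounded M₁ M₂) {PG : Matrix (Fin n) (Fin n) ℝ}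
    (hP : specNorm PG ≤ p) (X : Matrix (Fin n) (Fin (d 0)) ℝ) (k : ℕ) (hk : k ≤ r) :
    frob (hidden act w X PG k hk) ≤ L * M₁ * geo (tau L M₂ p) k * frob X := by
  simpa [hidden_zero_features hact] using frob_hidden_sub_le hact hM₂ hw hP X 0 k hk

/-- The factor `M₂` on the left turns the recursion coefficient `L³ p` into `τ`, avoids a division
by `M₂`, and is the form needed at the readout. Each layer adds one `M₁` from its perturbed `W` and
feeds in a fresh `M₂` from its perturbed `U`. -/
lemma frob_hidden_sub_weights_le (hact : act.Admissible L) (hM₁ : 0 ≤ M₁) (hM₂ : 0 ≤ M₂)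
    {w v : Weights r d} (hw : w.Bounded M₁ M₂) (hv : v.Bounded M₁ M₂) {t : ℝ} (ht : 0 ≤ t)
    (hW : ∀ k, specNorm (w.W k - v.W k) ≤ t) (hU : ∀ k, specNorm (w.U k - v.U k) ≤ t)
    {PG : Matrix (Fin n) (Fin n) ℝ} (hP : specNorm PG ≤ p)
    (X : Matrix (Fin n) (Fin (d 0)) ℝ) (k : ℕ) (hk : k ≤ r) :
    frob (hidden act w X PG k hk - hidden act v X PG k hk) * M₂ ≤
      L * t * (M₂ + k * M₁) * geo (tau L M₂ p) k * frob X := by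
  have hp : 0 ≤ p := (specNorm_nonneg _).trans hP
  have hL : (0 : ℝ) ≤ L := L.coe_nonneg
  have hX := frob_nonneg X
  induction k with
  | zero => simp [hidden, frob_zero, geo]
  | succ k ih =>
    have ih := ih (Nat.le_of_succ_le hk)
    have hF := frob_hidden_le hact hM₂ hv hP X k (Nat.le_of_succ_le hk)
    refine (mul_le_mul_of_nonneg_right
      (frob_hidden_succ_sub_le hact hM₂ hw ht hW hU hP X X k hk) hM₂).trans ?_
    rw [geo_succ, sub_self, frob_zero, zero_mul, zero_add]
    have hg : tau L M₂ p = (L : ℝ) ^ 3 * M₂ * p := rfl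
    have hτ := tau_nonneg (L := L) hM₂ hp
    calc (L * (frob X * t) + (L : ℝ) ^ 3 * p * (frob
          (hidden act w X PG k (Nat.le_of_succ_le hk) -
            hidden act v X PG k (Nat.le_of_succ_le hk)) * M₂ +
            frob (hidden act v X PG k (Nat.le_of_succ_le hk)) * t)) * M₂
        ≤ (L * (frob X * t) + (L : ℝ) ^ 3 * p *
          (L * t * (M₂ + k * M₁) * geo (tau L M₂ p) k * frob X +
            L * M₁ * geo (tau L M₂ p) k * frob X * t)) * M₂ := by gcongr
      _ = L * t * (M₂ + (M₂ + (k + 1) * M₁) * (tau L M₂ p * geo (tau L M₂ p) k)) * frob X := by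
          rw [hg]; ring
      _ ≤ L * t * (M₂ + ((k + 1 : ℕ) : ℝ) * M₁) * (1 + tau L M₂ p * geo (tau L M₂ p) k) *
          frob X := by
          push_cast
          have : 0 ≤ L * t * (((k : ℝ) + 1) * M₁) * frob X := by positivity
          nlinarith

lemma output_apply (P : Matrix (Fin n) (Fin n) ℝ → Matrix (Fin n) (Fin n) ℝ)
    (w : Weights r d) (G : Graph n (d 0)) (j : Fin (d (r + 1))) :
    output P act w G j = (1 / (n : ℝ)) *
      ∑ i, (hidden act w G.1 (P G.2) r le_rfl * w.W ⟨r, Nat.lt_succ_self r⟩) i j := by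
  simp [output, Matrix.vecMul, dotProduct]

/-- Averaging over the nodes gains `1 / √n`, which cancels the `√n` lost in passing from the
spectral to the Frobenius norm of the features. The final bound is therefore free of `n`. -/
lemma abs_mean_col_le {b : ℕ} (M : Matrix (Fin n) (Fin b) ℝ) (j : Fin b) {s : ℝ} (hs : 0 ≤ s)
    (h : frob M ≤ √n * s) : |(1 / (n : ℝ)) * ∑ i, M i j| ≤ s := by
  have h1 : |∑ i, M i j| ≤ n * s := by
    refine (abs_sum_col_le M j).trans ((mul_le_mul_of_nonneg_left h (Real.sqrt_nonneg _)).trans ?_)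
    rw [← mul_assoc, Real.mul_self_sqrt (Nat.cast_nonneg n)]
  rw [abs_mul, abs_of_nonneg (by positivity)]
  rcases Nat.eq_zero_or_pos n with rfl | hn
  · simpa using hs
  · have : (0 : ℝ) < n := by exact_mod_cast hn
    rw [one_div, inv_mul_le_iff₀ this]
    exact h1

variable {P : Matrix (Fin n) (Fin n) ℝ → Matrix (Fin n) (Fin n) ℝ}

lemma abs_output_sub_le (hact : act.Admissible L) (hM₁ : 0 ≤ M₁) (hM₂ : 0 ≤ M₂)
    {w : Weights r d} (hw : w.Bounded M₁ M₂) {A₁ A₂ : Matrix (Fin n) (Fin n) ℝ} (hA : A₁ = A₂)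
    (hP : specNorm (P A₁) ≤ p) (X₁ X₂ : Matrix (Fin n) (Fin (d 0)) ℝ) (j : Fin (d (r + 1))) :
    |output P act w (X₁, A₁) j - output P act w (X₂, A₂) j| ≤
      L * M₁ * M₂ * geo (tau L M₂ p) r * specNorm (X₁ - X₂) := by
  subst hA
  have hp : 0 ≤ p := (specNorm_nonneg _).trans hP
  have hτ := tau_nonneg (L := L) hM₂ hp
  have hg := geo_nonneg hτ r
  have hs := specNorm_nonneg (X₁ - X₂)
  rw [output_apply, output_apply, ← mul_sub, ← Finset.sum_sub_distrib]
  refine abs_mean_col_le (hidden act w X₁ (P A₁) r le_rfl * w.W ⟨r, Nat.lt_succ_self r⟩ -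
    hidden act w X₂ (P A₁) r le_rfl * w.W ⟨r, Nat.lt_succ_self r⟩) j (by positivity) ?_
  rw [← Matrix.sub_mul]
  calc _ ≤ L * M₁ * geo (tau L M₂ p) r * (√n * specNorm (X₁ - X₂)) * M₂ := by
        refine (frob_mul_le_right _ _).trans
          (mul_le_mul ?_ (hw.1 _) (specNorm_nonneg _) (by positivity))
        exact (frob_hidden_sub_le hact hM₂ hw hP X₁ X₂ r le_rfl).trans
          (mul_le_mul_of_nonneg_left (frob_le_specNorm _) (by positivity))
    _ = _ := by ring

lemma abs_output_le (hact : act.Admissible L) (hM₁ : 0 ≤ M₁) (hM₂ : 0 ≤ M₂)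
    {w : Weights r d} (hw : w.Bounded M₁ M₂) {G : Graph n (d 0)}
    (hP : specNorm (P G.2) ≤ p) (j : Fin (d (r + 1))) :
    |output P act w G j| ≤ L * M₁ * M₂ * geo (tau L M₂ p) r * specNorm G.1 := by
  have h0 : output P act w (0, G.2) j = 0 := by
    rw [output_apply, hidden_zero_features hact, Matrix.zero_mul]
    simp
  simpa [h0] using abs_output_sub_le hact hM₁ hM₂ hw rfl hP G.1 0 j

lemma abs_output_sub_weights_le (hact : act.Admissible L) (hM₁ : 0 ≤ M₁) (hM₂ : 0 ≤ M₂)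
    {w v : Weights r d} (hw : w.Bounded M₁ M₂) (hv : v.Bounded M₁ M₂) {t : ℝ} (ht : 0 ≤ t)
    (hW : ∀ k, specNorm (w.W k - v.W k) ≤ t) (hU : ∀ k, specNorm (w.U k - v.U k) ≤ t)
    {G : Graph n (d 0)} (hP : specNorm (P G.2) ≤ p) (j : Fin (d (r + 1))) :
    |output P act w G j - output P act v G j| ≤
      L * t * (M₂ + ((r + 1 : ℕ) : ℝ) * M₁) * geo (tau L M₂ p) r * specNorm G.1 := by
  have hp : 0 ≤ p := (specNorm_nonneg _).trans hP
  have hτ := tau_nonneg (L := L) hM₂ hp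
  have hg := geo_nonneg hτ r
  have hs := specNorm_nonneg G.1
  rw [output_apply, output_apply, ← mul_sub, ← Finset.sum_sub_distrib]
  refine abs_mean_col_le (hidden act w G.1 (P G.2) r le_rfl * w.W ⟨r, Nat.lt_succ_self r⟩ -
    hidden act v G.1 (P G.2) r le_rfl * v.W ⟨r, Nat.lt_succ_self r⟩) j (by positivity) ?_
  refine (frob_mul_sub_mul_le _ _ _ _ (hw.1 _) (hW _)).trans ?_
  calc _ ≤ L * t * (M₂ + r * M₁) * geo (tau L M₂ p) r * frob G.1 +
        L * M₁ * geo (tau L M₂ p) r * frob G.1 * t :=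
        add_le_add
          (frob_hidden_sub_weights_le hact hM₁ hM₂ hw hv ht hW hU hP G.1 r le_rfl)
          (mul_le_mul_of_nonneg_right (frob_hidden_le hact hM₂ hv hP G.1 r le_rfl) ht)
    _ = L * t * (M₂ + ((r + 1 : ℕ) : ℝ) * M₁) * geo (tau L M₂ p) r * frob G.1 := by
        push_cast; ring
    _ ≤ L * t * (M₂ + ((r + 1 : ℕ) : ℝ) * M₁) * geo (tau L M₂ p) r * (√n * specNorm G.1) :=
        mul_le_mul_of_nonneg_left (frob_le_specNorm _) (by positivity)
    _ = _ := by ring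

end Perturbation

/-! ### Stability and measurability of the robust margin. -/

section Margin

lemma margin_le_margin_add {K : ℕ} (hK : 2 ≤ K) {u v : Fin K → ℝ} {e : ℝ}
    (h : ∀ j, |u j - v j| ≤ e) (y : Fin K) : margin u y ≤ margin v y + 2 * e := by
  -- A second class is needed: over an empty index type the supremum would be the default value `0`.
  have : Nonempty {j : Fin K // j ≠ y} := by
    have : Nontrivial (Fin K) := Fin.nontrivial_iff_two_le.2 hK
    obtain ⟨j, hj⟩ := exists_ne y
    exact ⟨⟨j, hj⟩⟩
  have h1 : (⨆ j : {j : Fin K // j ≠ y}, v j) ≤ (⨆ j : {j : Fin K // j ≠ y}, u j) + e := by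
    refine ciSup_le fun j => ?_
    have h2 := le_ciSup (f := fun j : {j : Fin K // j ≠ y} => u j)
      (Set.finite_range _).bddAbove j
    have h3 := (abs_le.1 (h j)).1
    linarith
  have h2 := (abs_le.1 (h y)).2
  unfold margin
  linarith

lemma margin_zero {K : ℕ} (y : Fin K) : margin (0 : Fin K → ℝ) y = 0 := by
  simp [margin]

lemma abs_margin_le {K : ℕ} (hK : 2 ≤ K) {u : Fin K → ℝ} {e : ℝ}
    (h : ∀ j, |u j| ≤ e) (y : Fin K) : |margin u y| ≤ 2 * e := by
  have h1 := margin_le_margin_add hK (u := u) (v := 0) (by simpa using h) y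
  have h2 := margin_le_margin_add hK (u := 0) (v := u) (by simpa using h) y
  rw [margin_zero] at h1 h2
  exact abs_le.2 ⟨by linarith, by linarith⟩

lemma ciInf_le_ciInf_add {ι κ : Type*} [Nonempty κ] {f : ι → ℝ} {g : κ → ℝ} {e : ℝ}
    (hf : BddBelow (Set.range f)) (s : κ → ι) (h : ∀ k, f (s k) ≤ g k + e) :
    ⨅ i, f i ≤ (⨅ k, g k) + e := by
  rw [← sub_le_iff_le_add]
  refine le_ciInf fun k => ?_
  rw [sub_le_iff_le_add]
  exact (ciInf_le hf (s k)).trans (h k)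

variable {n r : ℕ} {d : ℕ → ℕ} {act : Activations r} {L : ℝ≥0} {M₁ M₂ p ε : ℝ}
  {P : Matrix (Fin n) (Fin n) ℝ → Matrix (Fin n) (Fin n) ℝ}
  {𝒢 : Set (Matrix (Fin n) (Fin n) ℝ)}

lemma attack_nonempty {h₀ : ℕ} (hε : 0 ≤ ε) (h𝒢 : 𝒢.Nonempty) (G : Graph n h₀) :
    Nonempty (attack ε 𝒢 G) := by
  obtain ⟨A, hA⟩ := h𝒢
  exact ⟨⟨(G.1, A), by simpa [specNorm_zero] using hε, hA⟩⟩

lemma specNorm_of_mem_attack {h₀ : ℕ} {G G' : Graph n h₀} (h : G' ∈ attack ε 𝒢 G) :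
    specNorm G'.1 ≤ specNorm G.1 + ε := by
  have h1 := specNorm_add_le G.1 (G'.1 - G.1)
  rw [add_sub_cancel] at h1
  linarith [h.1]

lemma abs_margin_output_le (hact : act.Admissible L) (hM₁ : 0 ≤ M₁) (hM₂ : 0 ≤ M₂)
    (hK : 2 ≤ d (r + 1)) (hP : ∀ A ∈ 𝒢, specNorm (P A) ≤ p) {w : Weights r d}
    (hw : w.Bounded M₁ M₂) (z : Sample n (d 0) (d (r + 1))) (G' : attack ε 𝒢 z.1) :
    |margin (output P act w G'.1) z.2| ≤
      2 * (L * M₁ * M₂ * geo (tau L M₂ p) r * (specNorm z.1.1 + ε)) := by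
  have hPG := hP _ G'.2.2
  have hp : 0 ≤ p := (specNorm_nonneg _).trans hPG
  have hg := geo_nonneg (tau_nonneg (L := L) hM₂ hp) r
  refine abs_margin_le hK (fun j => (abs_output_le hact hM₁ hM₂ hw hPG j).trans ?_) _
  exact mul_le_mul_of_nonneg_left (specNorm_of_mem_attack G'.2) (by positivity)

lemma bddBelow_margin_output (hact : act.Admissible L) (hM₁ : 0 ≤ M₁) (hM₂ : 0 ≤ M₂)
    (hK : 2 ≤ d (r + 1)) (hP : ∀ A ∈ 𝒢, specNorm (P A) ≤ p) {w : Weights r d}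
    (hw : w.Bounded M₁ M₂) (z : Sample n (d 0) (d (r + 1))) :
    BddBelow (Set.range fun G' : attack ε 𝒢 z.1 => margin (output P act w G'.1) z.2) := by
  refine ⟨-(2 * (L * M₁ * M₂ * geo (tau L M₂ p) r * (specNorm z.1.1 + ε))), ?_⟩
  rintro _ ⟨G', rfl⟩
  exact (abs_le.1 (abs_margin_output_le hact hM₁ hM₂ hK hP hw z G')).1

lemma robustMargin_le (hact : act.Admissible L) (hM₁ : 0 ≤ M₁) (hM₂ : 0 ≤ M₂)
    (hK : 2 ≤ d (r + 1)) (hP : ∀ A ∈ 𝒢, specNorm (P A) ≤ p) (hε : 0 ≤ ε) (h𝒢 : 𝒢.Nonempty)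
    {w : Weights r d} (hw : w.Bounded M₁ M₂) (z : Sample n (d 0) (d (r + 1))) :
    robustMargin ε 𝒢 P act w z ≤
      2 * (L * M₁ * M₂ * geo (tau L M₂ p) r * (specNorm z.1.1 + ε)) := by
  obtain ⟨G'⟩ := attack_nonempty hε h𝒢 z.1
  exact (ciInf_le (bddBelow_margin_output hact hM₁ hM₂ hK hP hw z) G').trans
    (abs_le.1 (abs_margin_output_le hact hM₁ hM₂ hK hP hw z G')).2

lemma robustMargin_le_add_of_weights (hact : act.Admissible L) (hM₁ : 0 ≤ M₁) (hM₂ : 0 ≤ M₂)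
    (hK : 2 ≤ d (r + 1)) (hP : ∀ A ∈ 𝒢, specNorm (P A) ≤ p) (hε : 0 ≤ ε) (h𝒢 : 𝒢.Nonempty)
    {w v : Weights r d} (hw : w.Bounded M₁ M₂) (hv : v.Bounded M₁ M₂) {t : ℝ} (ht : 0 ≤ t)
    (hW : ∀ k, specNorm (w.W k - v.W k) ≤ t) (hU : ∀ k, specNorm (w.U k - v.U k) ≤ t)
    (z : Sample n (d 0) (d (r + 1))) :
    robustMargin ε 𝒢 P act w z ≤ robustMargin ε 𝒢 P act v z +
      2 * (L * t * (M₂ + ((r + 1 : ℕ) : ℝ) * M₁) * geo (tau L M₂ p) r *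
        (specNorm z.1.1 + ε)) := by
  have := attack_nonempty hε h𝒢 z.1
  refine ciInf_le_ciInf_add (bddBelow_margin_output hact hM₁ hM₂ hK hP hw z) id fun G' => ?_
  have hPG := hP _ G'.2.2
  have hp : 0 ≤ p := (specNorm_nonneg _).trans hPG
  have hg := geo_nonneg (tau_nonneg (L := L) hM₂ hp) r
  refine margin_le_margin_add hK (fun j => (abs_output_sub_weights_le hact hM₁ hM₂ hw hv ht hW hU
    hPG j).trans ?_) _
  exact mul_le_mul_of_nonneg_left (specNorm_of_mem_attack G'.2) (by positivity)

lemma robustMargin_le_add_of_features (hact : act.Admissible L) (hM₁ : 0 ≤ M₁) (hM₂ : 0 ≤ M₂)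
    (hK : 2 ≤ d (r + 1)) (hP : ∀ A ∈ 𝒢, specNorm (P A) ≤ p) (hε : 0 ≤ ε) (h𝒢 : 𝒢.Nonempty)
    {w : Weights r d} (hw : w.Bounded M₁ M₂) (G₁ G₂ : Graph n (d 0)) (y : Fin (d (r + 1))) :
    robustMargin ε 𝒢 P act w (G₁, y) ≤ robustMargin ε 𝒢 P act w (G₂, y) +
      2 * (L * M₁ * M₂ * geo (tau L M₂ p) r * specNorm (G₁.1 - G₂.1)) := by
  have := attack_nonempty hε h𝒢 G₂
  refine ciInf_le_ciInf_add (bddBelow_margin_output hact hM₁ hM₂ hK hP hw (G₁, y))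
    -- Translation by `G₁.1 - G₂.1` carries attacks on `G₂` to attacks on `G₁`.
    (fun G' : attack ε 𝒢 G₂ => ⟨(G'.1.1 + (G₁.1 - G₂.1), G'.1.2), ?_, G'.2.2⟩) fun G' => ?_
  · have h : G'.1.1 + (G₁.1 - G₂.1) - G₁.1 = G'.1.1 - G₂.1 := by abel
    exact (congrArg specNorm h).trans_le G'.2.1
  · refine margin_le_margin_add hK (fun j => (abs_output_sub_le hact hM₁ hM₂ hw rfl
      (hP _ G'.2.2) _ _ j).trans_eq ?_) _
    rw [add_sub_cancel_left]

lemma continuous_robustMargin (hact : act.Admissible L) (hM₁ : 0 ≤ M₁) (hM₂ : 0 ≤ M₂)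
    (hK : 2 ≤ d (r + 1)) (hP : ∀ A ∈ 𝒢, specNorm (P A) ≤ p) (hε : 0 ≤ ε) (h𝒢 : 𝒢.Nonempty)
    {w : Weights r d} (hw : w.Bounded M₁ M₂) (A : Matrix (Fin n) (Fin n) ℝ)
    (y : Fin (d (r + 1))) : Continuous fun X : Matrix (Fin n) (Fin (d 0)) ℝ =>
      robustMargin ε 𝒢 P act w ((X, A), y) := by
  rw [continuous_iff_continuousAt]
  intro X₀
  rw [ContinuousAt, tendsto_iff_norm_sub_tendsto_zero]
  refine squeeze_zero (fun _ => norm_nonneg _)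
    (g := fun X => 2 * (L * M₁ * M₂ * geo (tau L M₂ p) r * specNorm (X - X₀))) (fun X => ?_) ?_
  · have h1 := robustMargin_le_add_of_features hact hM₁ hM₂ hK hP hε h𝒢 hw (X, A) (X₀, A) y
    have h2 := robustMargin_le_add_of_features hact hM₁ hM₂ hK hP hε h𝒢 hw (X₀, A) (X, A) y
    rw [← specNorm_neg, neg_sub] at h2
    rw [Real.norm_eq_abs]
    exact abs_le.2 ⟨by linarith, by linarith⟩
  · have h : Continuous fun X : Matrix (Fin n) (Fin (d 0)) ℝ =>
        2 * (L * M₁ * M₂ * geo (tau L M₂ p) r * specNorm (X - X₀)) := by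
      have := (continuous_specNorm (a := n) (b := d 0)).comp (continuous_id.sub
        (continuous_const (y := X₀)))
      exact continuous_const.mul (continuous_const.mul this)
    simpa [specNorm_zero] using h.tendsto X₀

/-- The attacker may choose any adjacency matrix in `𝒢`, so the original one does not matter.
Continuity in the features alone then gives measurability, with no regularity of `P` or `𝒢`. -/
lemma robustMargin_congr_adjacency (w : Weights r d) (X : Matrix (Fin n) (Fin (d 0)) ℝ)
    (A A' : Matrix (Fin n) (Fin n) ℝ) (y : Fin (d (r + 1))) :
    robustMargin ε 𝒢 P act w ((X, A), y) = robustMargin ε 𝒢 P act w ((X, A'), y) := by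
  simp only [robustMargin]
  rfl

instance instBorelSpaceMatrix (a b : ℕ) : BorelSpace (Matrix (Fin a) (Fin b) ℝ) :=
  inferInstanceAs (BorelSpace (Fin a → Fin b → ℝ))

lemma measurableSet_robustMargin_le (hact : act.Admissible L) (hM₁ : 0 ≤ M₁) (hM₂ : 0 ≤ M₂)
    (hK : 2 ≤ d (r + 1)) (hP : ∀ A ∈ 𝒢, specNorm (P A) ≤ p) (hε : 0 ≤ ε) (h𝒢 : 𝒢.Nonempty)
    {w : Weights r d} (hw : w.Bounded M₁ M₂) (s : ℝ) :
    MeasurableSet {z : Sample n (d 0) (d (r + 1)) | robustMargin ε 𝒢 P act w z ≤ s} := by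
  have hmeas : Measurable fun q : Fin (d (r + 1)) × Matrix (Fin n) (Fin (d 0)) ℝ =>
      robustMargin ε 𝒢 P act w ((q.2, 0), q.1) := by
    refine measurable_from_prod_countable_right fun y => ?_
    exact (continuous_robustMargin hact hM₁ hM₂ hK hP hε h𝒢 hw 0 y).measurable
  have hproj : Measurable fun z : Sample n (d 0) (d (r + 1)) => (z.2, z.1.1) :=
    measurable_snd.prodMk (measurable_fst.comp measurable_fst)
  have h := hproj (hmeas (measurableSet_Iic (a := s)))
  convert h using 1
  ext z
  simp only [Set.mem_ofPred_eq, Set.mem_preimage, Set.mem_Iic]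
  rw [robustMargin_congr_adjacency w z.1.1 0 z.1.2 z.2]

end Margin

/-! ### Gaussian measure: translation, tails and packing. -/

section Gaussian

open scoped RealInnerProductSpace

/-- The unnormalized standard Gaussian density. -/
def gaussDensity {V : Type*} [NormedAddCommGroup V] (u : V) : ℝ := Real.exp (-(‖u‖ ^ 2 / 2))

lemma gaussDensity_pos {V : Type*} [NormedAddCommGroup V] (u : V) : 0 < gaussDensity u := Real.exp_pos _

variable {V : Type*} [NormedAddCommGroup V] [InnerProductSpace ℝ V] [FiniteDimensional ℝ V]
  [MeasurableSpace V] [BorelSpace V]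

lemma integral_gaussDensity_pos : 0 < ∫ u : V, gaussDensity u := by
  have h := GaussianFourier.integral_rexp_neg_mul_sq_norm (V := V) (b := 1 / 2) (by norm_num)
  have h2 : (fun u : V => gaussDensity u) = fun v : V => Real.exp (-(1 / 2) * ‖v‖ ^ 2) := by
    funext u; unfold gaussDensity; congr 1; ring
  rw [h2, h]
  positivity

lemma integrable_gaussDensity : Integrable (gaussDensity : V → ℝ) :=
  Integrable.of_integral_ne_zero integral_gaussDensity_pos.ne'

lemma setIntegral_gaussDensity_translate (w : V) (S : Set V) :
    ∫ v in S, gaussDensity v = ∫ u in {u | u + w ∈ S}, gaussDensity (u + w) :=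
  ((measurePreserving_add_right volume w).setIntegral_preimage_emb
    (measurableEmbedding_addRight w) gaussDensity S).symm

lemma integrable_gaussDensity_translate (w : V) : Integrable fun u : V => gaussDensity (u + w) :=
  integrable_gaussDensity.comp_add_right w

/-- The Gaussian mass of a symmetric set drops by at most `exp (-‖w‖² / 2)` when it is
translated by `w`. -/
lemma exp_mul_setIntegral_le_translate {K : Set V}
    (hsymm : ∀ u ∈ K, -u ∈ K) (w : V) :
    Real.exp (-(‖w‖ ^ 2 / 2)) * ∫ u in K, gaussDensity u ≤
      ∫ v in {v | v - w ∈ K}, gaussDensity v := by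
  have h1 : ∫ v in {v | v - w ∈ K}, gaussDensity v = ∫ u in K, gaussDensity (u + w) := by
    rw [setIntegral_gaussDensity_translate w]
    simp
  have hpre : Neg.neg ⁻¹' K = K := by
    ext u
    exact ⟨fun h => by simpa using hsymm _ h, fun h => hsymm _ h⟩
  have h2 : ∫ u in K, gaussDensity (u + w) = ∫ u in K, gaussDensity (-u + w) := by
    have h := (Measure.measurePreserving_neg (volume : Measure V)).setIntegral_preimage_emb
      (MeasurableEquiv.neg V).measurableEmbedding (fun u => gaussDensity (u + w)) K
    rw [hpre] at h
    exact h.symm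
  have hi1 : IntegrableOn (fun u : V => gaussDensity (u + w)) K :=
    (integrable_gaussDensity_translate w).integrableOn
  have hi2 : IntegrableOn (fun u : V => gaussDensity (-u + w)) K :=
    ((integrable_gaussDensity_translate w).comp_neg).integrableOn
  -- By symmetry of `K` the shifted density may be averaged over `u` and `-u`. Relative to the
  -- original density the average is `exp (-‖w‖² / 2) cosh ⟪u, w⟫`, and `cosh ≥ 1`.
  have h3 : ∫ u in K, 2 * Real.exp (-(‖w‖ ^ 2 / 2)) * gaussDensity u ≤
      ∫ u in K, (gaussDensity (u + w) + gaussDensity (-u + w)) := by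
    refine setIntegral_mono ((integrable_gaussDensity.const_mul _).integrableOn) (hi1.add hi2)
      fun u => ?_
    have e1 : gaussDensity (u + w) =
        Real.exp (-(‖w‖ ^ 2 / 2)) * gaussDensity u * Real.exp (-⟪u, w⟫) := by
      unfold gaussDensity
      rw [← Real.exp_add, ← Real.exp_add, norm_add_sq_real]
      congr 1; ring
    have e2 : gaussDensity (-u + w) =
        Real.exp (-(‖w‖ ^ 2 / 2)) * gaussDensity u * Real.exp ⟪u, w⟫ := by
      unfold gaussDensity
      rw [← Real.exp_add, ← Real.exp_add, norm_add_sq_real, norm_neg, inner_neg_left]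
      congr 1; ring
    simp only [e1, e2]
    have h4 := Real.add_one_le_exp ⟪u, w⟫
    have h5 := Real.add_one_le_exp (-⟪u, w⟫)
    have h6 : 0 ≤ Real.exp (-(‖w‖ ^ 2 / 2)) * gaussDensity u :=
      mul_nonneg (Real.exp_pos _).le (gaussDensity_pos u).le
    nlinarith
  rw [integral_add hi1 hi2, ← h2, integral_const_mul] at h3
  rw [h1]
  linarith

/-- The unnormalized standard Gaussian measure. -/
def gaussMeasure (V : Type*) [NormedAddCommGroup V] [InnerProductSpace ℝ V]
    [FiniteDimensional ℝ V] [MeasurableSpace V] [BorelSpace V] : Measure V :=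
  volume.withDensity fun u => ENNReal.ofReal (gaussDensity u)

instance : IsFiniteMeasure (gaussMeasure V) :=
  isFiniteMeasure_withDensity_ofReal integrable_gaussDensity.2

lemma gaussMeasure_real {S : Set V} (hS : MeasurableSet S) :
    (gaussMeasure V).real S = ∫ u in S, gaussDensity u := by
  rw [Measure.real, gaussMeasure, withDensity_apply _ hS,
    ← ofReal_integral_eq_lintegral_ofReal integrable_gaussDensity.integrableOn
      (Filter.Eventually.of_forall fun u => (gaussDensity_pos u).le),
    ENNReal.toReal_ofReal (integral_nonneg fun u => (gaussDensity_pos u).le)]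

lemma gaussMeasure_real_univ_pos : 0 < (gaussMeasure V).real Set.univ := by
  rw [gaussMeasure_real MeasurableSet.univ, Measure.restrict_univ]
  exact integral_gaussDensity_pos

/-- After translation by `s • a` the density on the half-space is pointwise at most `exp (-s² / 2)`
times the original one. Only `‖a‖ ≤ 1` is needed, which suits the net points used below. -/
lemma gaussMeasure_halfspace_le {a : V} (ha : ‖a‖ ≤ 1) {s : ℝ} (hs : 0 ≤ s) :
    (gaussMeasure V).real {u | s ≤ ⟪a, u⟫} ≤
      Real.exp (-(s ^ 2 / 2)) * (gaussMeasure V).real Set.univ := by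
  have hS : MeasurableSet {u : V | s ≤ ⟪a, u⟫} :=
    (isClosed_le continuous_const (continuous_const.inner continuous_id)).measurableSet
  rw [gaussMeasure_real hS, gaussMeasure_real MeasurableSet.univ, Measure.restrict_univ,
    setIntegral_gaussDensity_translate (s • a)]
  have hS' : MeasurableSet {u : V | u + s • a ∈ {u : V | s ≤ ⟪a, u⟫}} :=
    measurable_id.add_const (s • a) hS
  calc ∫ u in {u : V | u + s • a ∈ {u : V | s ≤ ⟪a, u⟫}}, gaussDensity (u + s • a)
      ≤ ∫ u in {u : V | u + s • a ∈ {u : V | s ≤ ⟪a, u⟫}},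
          Real.exp (-(s ^ 2 / 2)) * gaussDensity u := by
        refine setIntegral_mono_on (integrable_gaussDensity_translate _).integrableOn
          ((integrable_gaussDensity.const_mul _).integrableOn) hS' fun u hu => ?_
        have hu' : s ≤ ⟪a, u⟫ + s * ‖a‖ ^ 2 := by
          have : s ≤ ⟪a, u + s • a⟫ := hu
          rwa [inner_add_right, inner_smul_right, real_inner_self_eq_norm_sq] at this
        have ha2 : ‖a‖ ^ 2 ≤ 1 := pow_le_one₀ (norm_nonneg _) ha
        unfold gaussDensity
        rw [← Real.exp_add, Real.exp_le_exp, norm_add_sq_real, norm_smul, inner_smul_right,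
          real_inner_comm, mul_pow, Real.norm_eq_abs, sq_abs]
        nlinarith [sq_nonneg s]
    _ ≤ ∫ u : V, Real.exp (-(s ^ 2 / 2)) * gaussDensity u :=
        setIntegral_le_integral (integrable_gaussDensity.const_mul _)
          (Filter.Eventually.of_forall fun u =>
            mul_nonneg (Real.exp_pos _).le (gaussDensity_pos u).le)
    _ = Real.exp (-(s ^ 2 / 2)) * ∫ u : V, gaussDensity u := integral_const_mul _ _

/-- Few points of a ball of radius `R` can have disjoint translates of a symmetric set that carries
half of the Gaussian mass. -/
lemma card_le_of_disjoint_translates {K : Set V} (hK : MeasurableSet K)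
    (hsymm : ∀ u ∈ K, -u ∈ K)
    (hmass : (gaussMeasure V).real Set.univ ≤ 2 * (gaussMeasure V).real K)
    {s : Finset V} {R : ℝ} (hs : ∀ w ∈ s, ‖w‖ ^ 2 ≤ R)
    (hdisj : ∀ w ∈ s, ∀ v ∈ s, w ≠ v → Disjoint {u | u - w ∈ K} {u | u - v ∈ K}) :
    (s.card : ℝ) ≤ 2 * Real.exp (R / 2) := by
  have hT : ∀ w : V, MeasurableSet {u | u - w ∈ K} := fun w => measurable_id.sub_const w hK
  have h1 : ∀ w ∈ s, Real.exp (-(R / 2)) * (gaussMeasure V).real K ≤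
      (gaussMeasure V).real {u | u - w ∈ K} := by
    intro w hw
    rw [gaussMeasure_real (hT w)]
    refine le_trans ?_ (exp_mul_setIntegral_le_translate hsymm w)
    rw [gaussMeasure_real hK]
    refine mul_le_mul_of_nonneg_right (Real.exp_le_exp.2 (by linarith [hs w hw]))
      (integral_nonneg fun u => (gaussDensity_pos u).le)
  have h2 : ∑ w ∈ s, (gaussMeasure V).real {u | u - w ∈ K} ≤ (gaussMeasure V).real Set.univ := by
    rw [← measureReal_biUnion_finset (fun w hw v hv h => hdisj w hw v hv h) fun w _ => hT w]
    exact measureReal_mono (Set.subset_univ _)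
  have h3 := (Finset.sum_le_sum h1).trans h2
  rw [Finset.sum_const, nsmul_eq_mul] at h3
  have hpos := gaussMeasure_real_univ_pos (V := V)
  have hKpos : 0 < (gaussMeasure V).real K := by linarith
  have h4 : (s.card : ℝ) * Real.exp (-(R / 2)) ≤ 2 := by
    by_contra! h
    nlinarith
  calc (s.card : ℝ) = s.card * Real.exp (-(R / 2)) * Real.exp (R / 2) := by
        rw [mul_assoc, ← Real.exp_add]; simp
    _ ≤ 2 * Real.exp (R / 2) := mul_le_mul_of_nonneg_right h4 (Real.exp_pos _).le

end Gaussian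

/-! ### Nets of the unit ball and the spectral norm. -/

section Nets

/-- A maximal separated subset is a net. -/
lemma exists_finset_net {α : Type*} (A : Set α) (near : α → α → Prop)
    (hrefl : ∀ x, near x x) (hsymm : ∀ x y, near x y → near y x) {N : ℕ}
    (hN : ∀ s : Finset α, ↑s ⊆ A → (∀ x ∈ s, ∀ y ∈ s, x ≠ y → ¬ near x y) → s.card ≤ N) :
    ∃ s : Finset α, ↑s ⊆ A ∧ (∀ x ∈ s, ∀ y ∈ s, x ≠ y → ¬ near x y) ∧
      ∀ x ∈ A, ∃ y ∈ s, near x y := by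
  classical
  let C : Set ℕ := {k | ∃ s : Finset α, ↑s ⊆ A ∧
    (∀ x ∈ s, ∀ y ∈ s, x ≠ y → ¬ near x y) ∧ s.card = k}
  have hne : C.Nonempty := ⟨0, ∅, by simp, by simp, rfl⟩
  have hbdd : BddAbove C := by
    refine ⟨N, ?_⟩
    rintro _ ⟨s, h1, h2, rfl⟩
    exact hN s h1 h2
  obtain ⟨s, hsA, hsep, hcard⟩ := Nat.sSup_mem hne hbdd
  refine ⟨s, hsA, hsep, fun x hx => ?_⟩
  by_contra! hfar
  have hxs : x ∉ s := fun h => hfar x h (hrefl x)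
  have hmem : (insert x s).card ∈ C := by
    refine ⟨insert x s, ?_, ?_, rfl⟩
    · rw [Finset.coe_insert]
      exact Set.insert_subset hx hsA
    · intro y hy z hz hyz
      rcases Finset.mem_insert.1 hy with hy' | hy' <;>
        rcases Finset.mem_insert.1 hz with hz' | hz'
      · exact absurd (hy'.trans hz'.symm) hyz
      · exact hy' ▸ hfar z hz'
      · exact fun h => hfar y hy' (hsymm _ _ (hz' ▸ h))
      · exact hsep y hy' z hz' hyz
  have := le_csSup hbdd hmem
  rw [Finset.card_insert_of_notMem hxs] at this
  omega

lemma exists_half_net (a : ℕ) : ∃ s : Finset (EuclideanSpace ℝ (Fin a)),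
    (∀ x ∈ s, ‖x‖ ≤ 1) ∧ s.card ≤ 5 ^ a ∧ ∀ x, ‖x‖ ≤ 1 → ∃ y ∈ s, ‖x - y‖ ≤ 1 / 2 := by
  classical
  have hN : ∀ s : Finset (EuclideanSpace ℝ (Fin a)),
      (s : Set (EuclideanSpace ℝ (Fin a))) ⊆ {x | ‖x‖ ≤ 1} →
      (∀ x ∈ s, ∀ y ∈ s, x ≠ y → ¬ ‖x - y‖ ≤ 1 / 2) → s.card ≤ 5 ^ a := by
    intro s hs hsep
    have hinj : Function.Injective fun x : EuclideanSpace ℝ (Fin a) => (2 : ℝ) • x :=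
      smul_right_injective _ two_ne_zero
    -- Doubling turns radius `1` and separation `1 / 2` into the radius `2` and separation `1` of
    -- the Besicovitch bound `5 ^ dim`.
    have h := Besicovitch.card_le_of_separated
      (s.image fun x : EuclideanSpace ℝ (Fin a) => (2 : ℝ) • x) ?_ ?_
    · rwa [Finset.card_image_of_injective _ hinj, finrank_euclideanSpace_fin] at h
    · intro c hc
      obtain ⟨x, hx, rfl⟩ := Finset.mem_image.1 hc
      have : ‖x‖ ≤ 1 := hs hx
      rw [norm_smul]
      norm_num
      linarith
    · intro c hc e he hne
      obtain ⟨x, hx, rfl⟩ := Finset.mem_image.1 hc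
      obtain ⟨y, hy, rfl⟩ := Finset.mem_image.1 he
      have := not_le.1 (hsep x hx y hy fun h => hne (by rw [h]))
      rw [← smul_sub, norm_smul]
      norm_num
      linarith
  obtain ⟨s, h1, h2, h3⟩ := exists_finset_net {x : EuclideanSpace ℝ (Fin a) | ‖x‖ ≤ 1}
    (fun x y => ‖x - y‖ ≤ 1 / 2) (by simp) (fun x y h => by rwa [norm_sub_rev]) hN
  exact ⟨s, h1, hN s h1 h2, h3⟩

/-- The spectral norm is controlled by the bilinear form on nets of the two unit balls. -/
lemma specNorm_le_of_nets {a b : ℕ} (M : Matrix (Fin a) (Fin b) ℝ)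
    {sa : Finset (EuclideanSpace ℝ (Fin a))} {sb : Finset (EuclideanSpace ℝ (Fin b))}
    (ha : ∀ x, ‖x‖ ≤ 1 → ∃ y ∈ sa, ‖x - y‖ ≤ 1 / 2)
    (hb : ∀ x, ‖x‖ ≤ 1 → ∃ y ∈ sb, ‖x - y‖ ≤ 1 / 2) {t : ℝ}
    (h : ∀ y ∈ sa, ∀ x ∈ sb, inner ℝ y (Matrix.toEuclideanLin M x) ≤ t / 4) :
    specNorm M ≤ t := by
  set T := (Matrix.toEuclideanLin M).toContinuousLinearMap with hT
  -- A net point within `1 / 2` of `z / ‖z‖` sees at least half of `‖z‖`. The net in the argument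
  -- `x` loses a second factor `2`, hence `t / 4` in the hypothesis.
  have key : ∀ z : EuclideanSpace ℝ (Fin a), (∀ y ∈ sa, inner ℝ y z ≤ t / 4) → ‖z‖ ≤ t / 2 := by
    intro z hz
    obtain ⟨y, hy, hyn⟩ := ha (‖z‖⁻¹ • z) (by
      rw [norm_smul, norm_inv, norm_norm]; exact inv_mul_le_one)
    have h1 : inner ℝ (‖z‖⁻¹ • z - y) z ≤ 1 / 2 * ‖z‖ :=
      (real_inner_le_norm _ _).trans (mul_le_mul_of_nonneg_right hyn (norm_nonneg _))
    have h2 : inner ℝ (‖z‖⁻¹ • z) z = ‖z‖ := by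
      rw [real_inner_smul_left, real_inner_self_eq_norm_sq]
      rcases eq_or_ne ‖z‖ 0 with h0 | h0
      · simp [h0]
      · field_simp
    rw [inner_sub_left, h2] at h1
    linarith [hz y hy]
  have ht : 0 ≤ t := by
    obtain ⟨x, hx, -⟩ := hb 0 (by simp)
    linarith [(norm_nonneg _).trans (key _ fun y hy => h y hy x hx)]
  have h1 : ‖T‖ ≤ t / 2 + ‖T‖ / 2 := by
    refine ContinuousLinearMap.opNorm_le_of_unit_norm (by positivity) fun x hx => ?_
    obtain ⟨y, hy, hyn⟩ := hb x hx.le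
    calc ‖T x‖ = ‖T y + T (x - y)‖ := by rw [map_sub]; congr 1; abel
      _ ≤ ‖T y‖ + ‖T (x - y)‖ := norm_add_le _ _
      _ ≤ t / 2 + ‖T‖ * (1 / 2) := by
        refine add_le_add (key _ fun z hz => h z hz y hy) ?_
        exact (T.le_opNorm _).trans (mul_le_mul_of_nonneg_left hyn (norm_nonneg _))
      _ = _ := by ring
  have h2 : specNorm M = ‖T‖ := rfl
  linarith

end Nets

/-! ### Spectral norm of a Gaussian matrix. -/

section GaussianMatrices

variable {ι : Type*}

/-- The matrix whose entries are the coordinates of `u` selected by `e`. -/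
def entries {a b : ℕ} (e : Fin a × Fin b → ι) (u : EuclideanSpace ℝ ι) :
    Matrix (Fin a) (Fin b) ℝ :=
  Matrix.of fun i j => u (e (i, j))

lemma entries_sub {a b : ℕ} (e : Fin a × Fin b → ι) (u v : EuclideanSpace ℝ ι) :
    entries e (u - v) = entries e u - entries e v := rfl

lemma entries_neg {a b : ℕ} (e : Fin a × Fin b → ι) (u : EuclideanSpace ℝ ι) :
    entries e (-u) = -entries e u := rfl

lemma entries_smul {a b : ℕ} (e : Fin a × Fin b → ι) (s : ℝ) (u : EuclideanSpace ℝ ι) :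
    entries e (s • u) = s • entries e u := rfl

lemma continuous_entries {a b : ℕ} (e : Fin a × Fin b → ι) : Continuous (entries e) := by
  refine continuous_matrix fun i j => ?_
  exact EuclideanSpace.proj (𝕜 := ℝ) (e (i, j)) |>.continuous

variable [Fintype ι]

/-- The functional is represented by `y ⊗ x` placed on the coordinates chosen by `e`. Injectivity
keeps these coordinates orthonormal, so its norm is `‖y‖ ‖x‖`. -/
lemma exists_unit_inner_eq_bilinear {a b : ℕ} {e : Fin a × Fin b → ι}
    (he : Function.Injective e) {y : EuclideanSpace ℝ (Fin a)} {x : EuclideanSpace ℝ (Fin b)}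
    (hy : ‖y‖ ≤ 1) (hx : ‖x‖ ≤ 1) : ∃ g : EuclideanSpace ℝ ι, ‖g‖ ≤ 1 ∧
      ∀ u, inner ℝ y (Matrix.toEuclideanLin (entries e u) x) = inner ℝ g u := by
  have ho := (EuclideanSpace.basisFun ι ℝ).orthonormal.comp e he
  refine ⟨∑ q : Fin a × Fin b, (y q.1 * x q.2) • EuclideanSpace.basisFun ι ℝ (e q), ?_, ?_⟩
  · refine le_of_sq_le_sq ?_ zero_le_one
    have h := ho.inner_sum (fun q => y q.1 * x q.2) (fun q => y q.1 * x q.2) Finset.univ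
    simp only [Function.comp_apply] at h
    rw [← real_inner_self_eq_norm_sq, h, Fintype.sum_prod_type]
    have h2 : ∑ i, ∑ j, (starRingEnd ℝ) (y i * x j) * (y i * x j) = ‖y‖ ^ 2 * ‖x‖ ^ 2 := by
      rw [EuclideanSpace.real_norm_sq_eq, EuclideanSpace.real_norm_sq_eq, Finset.sum_mul_sum]
      refine Finset.sum_congr rfl fun i _ => Finset.sum_congr rfl fun j _ => ?_
      rw [conj_trivial]; ring
    rw [h2, ← mul_pow]
    exact pow_le_pow_left₀ (by positivity)
      (mul_le_one₀ hy (norm_nonneg _) hx) 2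
  · intro u
    rw [sum_inner, Fintype.sum_prod_type]
    simp only [inner_smul_left, conj_trivial, EuclideanSpace.basisFun_inner]
    rw [EuclideanSpace.inner_eq_star_dotProduct]
    simp only [dotProduct, Matrix.ofLp_toLpLin, Matrix.toLin'_apply, Matrix.mulVec,
      star_trivial, entries, Matrix.of_apply, Finset.sum_mul]
    refine Finset.sum_congr rfl fun i _ => Finset.sum_congr rfl fun j _ => ?_
    ring

/-- Union bound over at most `5 ^ h * 5 ^ h` pairs of net points. Each pair is a half-space event at
level `t / 4`, and `(t / 4)² / 2 = t² / 32`. -/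
lemma gaussMeasure_specNorm_entries_le {a b h : ℕ} (ha : a ≤ h) (hb : b ≤ h)
    {e : Fin a × Fin b → ι} (he : Function.Injective e) {t : ℝ} (ht : 0 ≤ t) :
    (gaussMeasure (EuclideanSpace ℝ ι)).real {u | t < specNorm (entries e u)} ≤
      25 ^ h * Real.exp (-(t ^ 2 / 32)) *
        (gaussMeasure (EuclideanSpace ℝ ι)).real Set.univ := by
  obtain ⟨sa, ha1, hac, han⟩ := exists_half_net a
  obtain ⟨sb, hb1, hbc, hbn⟩ := exists_half_net b
  set μ := gaussMeasure (EuclideanSpace ℝ ι)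
  have hsub : {u | t < specNorm (entries e u)} ⊆ ⋃ q ∈ sa ×ˢ sb,
      {u | t / 4 ≤ inner ℝ q.1 (Matrix.toEuclideanLin (entries e u) q.2)} := by
    intro u hu
    by_contra hcon
    simp only [Set.mem_iUnion, Set.mem_ofPred_eq, not_exists, not_le, Finset.mem_product] at hcon
    exact absurd (specNorm_le_of_nets (entries e u) han hbn fun y hy x hx =>
      (hcon (y, x) ⟨hy, hx⟩).le) (not_le.2 hu)
  have hq : ∀ q ∈ sa ×ˢ sb,
      μ.real {u | t / 4 ≤ inner ℝ q.1 (Matrix.toEuclideanLin (entries e u) q.2)} ≤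
        Real.exp (-(t ^ 2 / 32)) * μ.real Set.univ := by
    intro q hq
    obtain ⟨h1, h2⟩ := Finset.mem_product.1 hq
    obtain ⟨g, hg, hgu⟩ := exists_unit_inner_eq_bilinear he (ha1 _ h1) (hb1 _ h2)
    simp only [hgu]
    refine (gaussMeasure_halfspace_le hg (by positivity)).trans_eq ?_
    congr 3; ring
  have hcard : ((sa ×ˢ sb).card : ℝ) ≤ 25 ^ h := by
    have h1 : sa.card ≤ 5 ^ h := hac.trans (Nat.pow_le_pow_right (by norm_num) ha)
    have h2 : sb.card ≤ 5 ^ h := hbc.trans (Nat.pow_le_pow_right (by norm_num) hb)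
    rw [Finset.card_product]
    have h3 : sa.card * sb.card ≤ 25 ^ h := by
      calc sa.card * sb.card ≤ 5 ^ h * 5 ^ h := Nat.mul_le_mul h1 h2
        _ = 25 ^ h := by rw [← mul_pow]; norm_num
    exact_mod_cast h3
  calc μ.real {u | t < specNorm (entries e u)}
      ≤ μ.real (⋃ q ∈ sa ×ˢ sb,
        {u | t / 4 ≤ inner ℝ q.1 (Matrix.toEuclideanLin (entries e u) q.2)}) :=
        measureReal_mono hsub (measure_ne_top _ _)
    _ ≤ ∑ q ∈ sa ×ˢ sb,
        μ.real {u | t / 4 ≤ inner ℝ q.1 (Matrix.toEuclideanLin (entries e u) q.2)} :=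
        measureReal_biUnion_finset_le _ _
    _ ≤ ∑ _q ∈ sa ×ˢ sb, Real.exp (-(t ^ 2 / 32)) * μ.real Set.univ := Finset.sum_le_sum hq
    _ = (sa ×ˢ sb).card * (Real.exp (-(t ^ 2 / 32)) * μ.real Set.univ) := by
        rw [Finset.sum_const, nsmul_eq_mul]
    _ ≤ 25 ^ h * (Real.exp (-(t ^ 2 / 32)) * μ.real Set.univ) := by gcongr
    _ = _ := by ring

end GaussianMatrices

/-! ### Covering the weights by Gaussian packing. -/

section WeightSpace

variable {r : ℕ} {d : ℕ → ℕ}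

/-- The index set of all scalar parameters. -/
abbrev WeightIndex (r : ℕ) (d : ℕ → ℕ) : Type :=
  (Σ k : Fin (r + 1), Fin (d k) × Fin (d (k + 1))) ⊕ (Σ k : Fin r, Fin (d 0) × Fin (d (k + 1)))

/-- The space of all scalar parameters, with the Euclidean norm `|w|₂`. -/
abbrev WeightSpace (r : ℕ) (d : ℕ → ℕ) : Type := EuclideanSpace ℝ (WeightIndex r d)

/-- The coordinates of the matrix `W k`. -/
def idxW (k : Fin (r + 1)) (q : Fin (d k) × Fin (d (k + 1))) : WeightIndex r d := Sum.inl ⟨k, q⟩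

/-- The coordinates of the matrix `U k`. -/
def idxU (k : Fin r) (q : Fin (d 0) × Fin (d (k + 1))) : WeightIndex r d := Sum.inr ⟨k, q⟩

lemma idxW_injective (k : Fin (r + 1)) : Function.Injective (idxW (d := d) k) := fun a b h => by
  simpa [idxW] using h

lemma idxU_injective (k : Fin r) : Function.Injective (idxU (d := d) k) := fun a b h => by
  simpa [idxU] using h

/-- The parameters of a network as a vector. -/
def Weights.toVec (w : Weights r d) : WeightSpace r d :=
  WithLp.toLp 2 (Sum.elim (fun q => w.W q.1 q.2.1 q.2.2) (fun q => w.U q.1 q.2.1 q.2.2))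

/-- The network with a given vector of parameters. -/
def Weights.ofVec (u : WeightSpace r d) : Weights r d where
  W k := entries (idxW k) u
  U k := entries (idxU k) u

lemma normSq_eq (w : Weights r d) : normSq w = ‖w.toVec‖ ^ 2 := by
  rw [EuclideanSpace.real_norm_sq_eq, Fintype.sum_sum_type, Fintype.sum_sigma, Fintype.sum_sigma]
  simp only [Fintype.sum_prod_type]
  rfl

/-- Parameter vectors all of whose weight matrices have spectral norm at most `t`. -/
def specBall (r : ℕ) (d : ℕ → ℕ) (t : ℝ) : Set (WeightSpace r d) :=
  {u | (∀ k, specNorm (entries (idxW k) u) ≤ t) ∧ ∀ k, specNorm (entries (idxU k) u) ≤ t}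

lemma neg_mem_specBall {t : ℝ} {u : WeightSpace r d} (hu : u ∈ specBall r d t) :
    -u ∈ specBall r d t := by
  refine ⟨fun k => ?_, fun k => ?_⟩
  · rw [entries_neg, specNorm_neg]; exact hu.1 k
  · rw [entries_neg, specNorm_neg]; exact hu.2 k

lemma measurableSet_specBall (t : ℝ) : MeasurableSet (specBall r d t) := by
  refine IsClosed.measurableSet ?_
  have h : specBall r d t = (⋂ k, {u | specNorm (entries (idxW k) u) ≤ t}) ∩
      ⋂ k, {u | specNorm (entries (idxU k) u) ≤ t} := by
    ext u; simp [specBall]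
  rw [h]
  exact (isClosed_iInter fun k => isClosed_le
      (continuous_specNorm.comp (continuous_entries _)) continuous_const).inter
    (isClosed_iInter fun k => isClosed_le
      (continuous_specNorm.comp (continuous_entries _)) continuous_const)

/-- Union bound over the `2 r + 1` weight matrices; `hexp` says that the total failure probability
is at most one half. -/
lemma gaussMeasure_specBall {h : ℕ} (hd : ∀ k ≤ r + 1, d k ≤ h) {t : ℝ} (ht : 0 ≤ t)
    (hexp : 2 * ((2 * (r : ℝ) + 1) * (25 ^ h * Real.exp (-(t ^ 2 / 32)))) ≤ 1) :
    (gaussMeasure (WeightSpace r d)).real Set.univ ≤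
      2 * (gaussMeasure (WeightSpace r d)).real (specBall r d t) := by
  set μ := gaussMeasure (WeightSpace r d)
  set c := 25 ^ h * Real.exp (-(t ^ 2 / 32)) * μ.real Set.univ with hc
  have hsub : (specBall r d t)ᶜ ⊆ (⋃ k, {u | t < specNorm (entries (idxW k) u)}) ∪
      ⋃ k, {u | t < specNorm (entries (idxU k) u)} := by
    intro u hu
    by_contra hcon
    simp only [Set.mem_union, Set.mem_iUnion, Set.mem_ofPred_eq, not_or, not_exists,
      not_lt] at hcon
    exact hu hcon
  have h1 : μ.real (specBall r d t)ᶜ ≤ (2 * (r : ℝ) + 1) * c := by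
    refine (measureReal_mono hsub).trans ((measureReal_union_le _ _).trans ?_)
    have hW : μ.real (⋃ k : Fin (r + 1), {u | t < specNorm (entries (idxW (d := d) k) u)}) ≤ (r + 1) * c := by
      refine (measureReal_iUnion_fintype_le _).trans ((Finset.sum_le_sum fun (k : Fin (r + 1)) _ =>
        gaussMeasure_specNorm_entries_le (hd k (by omega)) (hd (k + 1) (by omega))
          (idxW_injective k) ht).trans_eq ?_)
      simp [hc, μ]
    have hU : μ.real (⋃ k : Fin r, {u | t < specNorm (entries (idxU (d := d) k) u)}) ≤ r * c := by
      refine (measureReal_iUnion_fintype_le _).trans ((Finset.sum_le_sum fun (k : Fin r) _ =>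
        gaussMeasure_specNorm_entries_le (hd 0 (by omega)) (hd (k + 1) (by omega))
          (idxU_injective k) ht).trans_eq ?_)
      simp [hc, μ]
    linarith
  have h2 : μ.real (specBall r d t) + μ.real (specBall r d t)ᶜ = μ.real Set.univ :=
    measureReal_add_measureReal_compl (measurableSet_specBall t)
  have h3 := gaussMeasure_real_univ_pos (V := WeightSpace r d)
  have h4 : 2 * ((2 * (r : ℝ) + 1) * c) ≤ μ.real Set.univ := by
    rw [hc]
    have := mul_le_mul_of_nonneg_right hexp h3.le
    linarith
  linarith

/-- **Dual Sudakov bound** for networks: the parameters with `|w|₂² ≤ s² R` have a net of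
cardinality `2 exp (R / 2)` in the maximum of the spectral norms over all weight matrices. -/
lemma exists_weights_net {h : ℕ} (hd : ∀ k ≤ r + 1, d k ≤ h) {t : ℝ} (ht : 0 ≤ t)
    (hexp : 2 * ((2 * (r : ℝ) + 1) * (25 ^ h * Real.exp (-(t ^ 2 / 32)))) ≤ 1)
    {s : ℝ} (hs : 0 < s) (M₁ M₂ R : ℝ) :
    ∃ N : Finset (WeightSpace r d), (N.card : ℝ) ≤ 2 * Real.exp (R / 2) ∧
      (∀ x ∈ N, (Weights.ofVec (s • x)).Bounded M₁ M₂) ∧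
      ∀ w : Weights r d, w.Bounded M₁ M₂ → normSq w ≤ s ^ 2 * R → ∃ x ∈ N,
        (∀ k, specNorm (w.W k - (Weights.ofVec (s • x)).W k) ≤ 2 * s * t) ∧
        ∀ k, specNorm (w.U k - (Weights.ofVec (s • x)).U k) ≤ 2 * s * t := by
  -- Net points must satisfy the norm bounds themselves, because the perturbation estimate needs
  -- both networks bounded.
  set A : Set (WeightSpace r d) :=
    {x | (Weights.ofVec (s • x)).Bounded M₁ M₂ ∧ ‖x‖ ^ 2 ≤ R} with hA
  -- Two points are near when their translates of the ball meet. Separated points then have disjoint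
  -- translates, and near points differ by at most `2 t` in each spectral norm.
  let near : WeightSpace r d → WeightSpace r d → Prop := fun x y =>
    ∃ u, u - x ∈ specBall r d t ∧ u - y ∈ specBall r d t
  have h0 : (0 : WeightSpace r d) ∈ specBall r d t := by
    have : ∀ {a b : ℕ} (e : Fin a × Fin b → WeightIndex r d),
      entries e (0 : WeightSpace r d) = 0 := fun e => rfl
    simp [specBall, this, specNorm_zero, ht]
  have hcard : ∀ N : Finset (WeightSpace r d), (N : Set (WeightSpace r d)) ⊆ A →
      (∀ x ∈ N, ∀ y ∈ N, x ≠ y → ¬ near x y) → (N.card : ℝ) ≤ 2 * Real.exp (R / 2) := by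
    intro N hN hsep
    refine card_le_of_disjoint_translates (measurableSet_specBall t)
      (fun u hu => neg_mem_specBall hu) (gaussMeasure_specBall hd ht hexp)
      (fun x hx => (hN hx).2) fun x hx y hy hxy => ?_
    rw [Set.disjoint_left]
    exact fun u hu hu' => hsep x hx y hy hxy ⟨u, hu, hu'⟩
  obtain ⟨N, hNA, hsep, hnet⟩ := exists_finset_net A near
    (fun x => ⟨x, by simpa using h0, by simpa using h0⟩)
    (fun x y ⟨u, h1, h2⟩ => ⟨u, h2, h1⟩) (N := ⌊2 * Real.exp (R / 2)⌋₊)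
    fun N h1 h2 => Nat.le_floor (hcard N h1 h2)
  refine ⟨N, hcard N hNA hsep, fun x hx => (hNA hx).1, fun w hw hwR => ?_⟩
  have hsx : s • (s⁻¹ • w.toVec) = w.toVec := smul_inv_smul₀ hs.ne' _
  have hmem : s⁻¹ • w.toVec ∈ A := by
    refine ⟨by rw [hsx]; exact hw, ?_⟩
    rw [norm_smul, mul_pow, ← normSq_eq, Real.norm_eq_abs, sq_abs, inv_pow]
    rw [inv_mul_le_iff₀ (by positivity)]
    exact hwR
  obtain ⟨x, hx, u, hu1, hu2⟩ := hnet _ hmem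
  have key : ∀ {a b : ℕ} (e : Fin a × Fin b → WeightIndex r d),
      specNorm (entries e (u - s⁻¹ • w.toVec)) ≤ t → specNorm (entries e (u - x)) ≤ t →
      specNorm (entries e w.toVec - entries e (s • x)) ≤ 2 * s * t := by
    intro a b e h1 h2
    have h3 : entries e w.toVec - entries e (s • x) =
        s • (entries e (u - x) - entries e (u - s⁻¹ • w.toVec)) := by
      rw [← entries_sub, ← entries_sub, ← entries_smul]
      congr 1
      rw [sub_sub_sub_cancel_left, smul_sub, hsx]
    rw [h3, specNorm_smul, abs_of_pos hs]
    have := specNorm_sub_le (entries e (u - x)) (entries e (u - s⁻¹ • w.toVec))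
    nlinarith
  exact ⟨x, hx, fun k => key (idxW k) (hu1.1 k) (hu2.1 k), fun k => key (idxU k) (hu1.2 k) (hu2.2 k)⟩

end WeightSpace

/-! ### Hoeffding's inequality and a union bound over all budgets. -/

section Concentration

variable {Ω : Type*} [MeasurableSpace Ω] {D : Measure Ω}

open Classical in
/-- The fraction of the points of a sample that lie in `A`. -/
def empFreq {m : ℕ} (S : Fin m → Ω) (A : Set Ω) : ℝ :=
  (1 / (m : ℝ)) * ∑ i, if S i ∈ A then 1 else 0

lemma measurableSet_empFreq_add_le {m : ℕ} {A : Set Ω} (hA : MeasurableSet A) (s : ℝ) :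
    MeasurableSet {S : Fin m → Ω | empFreq S A + s ≤ D.real A} := by
  classical
  refine measurableSet_le (Measurable.add_const ?_ _) measurable_const
  refine Measurable.const_mul (Finset.measurable_sum _ fun i _ => ?_) _
  exact Measurable.ite (measurable_pi_apply i hA) measurable_const measurable_const

variable [IsProbabilityMeasure D]

/-- **Hoeffding's inequality** for the empirical frequency of an event. -/
lemma measure_empFreq_add_le {m : ℕ} (hm : 1 ≤ m) {A : Set Ω} (hA : MeasurableSet A) {s : ℝ}
    (hs : 0 ≤ s) :
    (Measure.pi fun _ : Fin m => D).real {S | empFreq S A + s ≤ D.real A} ≤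
      Real.exp (-(2 * m * s ^ 2)) := by
  classical
  let f : Ω → ℝ := fun z => D.real A - A.indicator (fun _ => 1) z
  have hind : Measurable (A.indicator fun _ : Ω => (1 : ℝ)) := measurable_const.indicator hA
  have hf : Measurable f := measurable_const.sub hind
  have hint : ∫ z, A.indicator (fun _ => (1 : ℝ)) z ∂D = D.real A := by
    rw [integral_indicator_const _ hA]; simp
  have hsub : ProbabilityTheory.HasSubgaussianMGF f (1 / 4) D := by
    have h := ProbabilityTheory.hasSubgaussianMGF_of_mem_Icc (μ := D) hind.aemeasurable
      (a := 0) (b := 1) (Filter.Eventually.of_forall fun z => by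
        by_cases hz : z ∈ A <;> simp [hz])
    rw [hint] at h
    have h2 := h.neg
    have e1 : (‖(1 : ℝ) - 0‖₊ / 2) ^ 2 = (1 / 4 : ℝ≥0) := by
      rw [sub_zero, nnnorm_one]; norm_num
    rw [e1] at h2
    convert h2 using 1
    funext z
    simp [f]
  let X : Fin m → (Fin m → Ω) → ℝ := fun i S => f (S i)
  have hindep : ProbabilityTheory.iIndepFun X (Measure.pi fun _ : Fin m => D) :=
    ProbabilityTheory.iIndepFun_pi (X := fun _ => f) fun _ => hf.aemeasurable
  have hX : ∀ i ∈ (Finset.univ : Finset (Fin m)),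
      ProbabilityTheory.HasSubgaussianMGF (X i) (1 / 4) (Measure.pi fun _ : Fin m => D) := by
    intro i _
    refine ProbabilityTheory.HasSubgaussianMGF.of_map (Y := fun S : Fin m → Ω => S i)
      (X := f) (measurable_pi_apply i).aemeasurable ?_
    rw [(measurePreserving_eval (fun _ : Fin m => D) i).map_eq]
    exact hsub
  have hmpos : (0 : ℝ) < m := by exact_mod_cast hm
  have h := ProbabilityTheory.HasSubgaussianMGF.measure_sum_ge_le_of_iIndepFun hindep hX
    (ε := m * s) (by positivity)
  have hset : {S : Fin m → Ω | empFreq S A + s ≤ D.real A} =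
      {S | m * s ≤ ∑ i, X i S} := by
    ext S
    have hsum : ∑ i, X i S = m * (D.real A - empFreq S A) := by
      simp only [X, f, Finset.sum_sub_distrib, empFreq, Set.indicator_apply]
      rw [mul_sub, ← mul_assoc, mul_one_div_cancel hmpos.ne', one_mul]
      simp
    simp only [Set.mem_ofPred_eq, hsum]
    rw [mul_le_mul_iff_right₀ hmpos]
    constructor <;> intro h <;> linarith
  rw [hset]
  refine h.trans_eq ?_
  congr 1
  simp
  field_simp
  ring

/-- A uniform deviation bound for countably many finite families of events, the `k`-th of which has
at most `2 exp (k / 2)` members. -/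
lemma exists_uniform_event {m : ℕ} (hm : 1 ≤ m) {δ : ℝ} (hδ : 0 < δ) (hδ1 : δ < 1)
    {V : Type*} (N : ℕ → Finset V) (hN : ∀ k, ((N k).card : ℝ) ≤ 2 * Real.exp ((k : ℝ) / 2))
    (A : V → Set Ω) (hA : ∀ k, ∀ v ∈ N k, MeasurableSet (A v)) :
    ∃ E : Set (Fin m → Ω), MeasurableSet E ∧ 1 - δ ≤ (Measure.pi fun _ : Fin m => D).real E ∧
      ∀ S ∈ E, ∀ k, ∀ v ∈ N k,
        D.real (A v) ≤ empFreq S (A v) +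
          √((Real.log (1 / δ) + 2 * ((k : ℝ) + 1)) / (2 * m)) := by
  set μ := Measure.pi fun _ : Fin m => D
  -- Chosen so that one event fails with probability at most `δ exp (-2 (k + 1))`. This beats the
  -- cardinality `2 exp (k / 2)` and leaves `δ 2^(-(k + 1))`, which sums to `δ` over `k`.
  let s : ℕ → ℝ := fun k => √((Real.log (1 / δ) + 2 * ((k : ℝ) + 1)) / (2 * m))
  let Bad : ℕ → V → Set (Fin m → Ω) := fun k v => {S | empFreq S (A v) + s k ≤ D.real (A v)}
  have hmpos : (0 : ℝ) < m := by exact_mod_cast hm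
  have hlog : 0 < Real.log (1 / δ) := Real.log_pos (by rw [lt_div_iff₀ hδ]; linarith)
  have hexp : ∀ k, Real.exp (-(2 * m * s k ^ 2)) = δ * Real.exp (-(2 * ((k : ℝ) + 1))) := by
    intro k
    rw [Real.sq_sqrt (by positivity)]
    have : -(2 * m * ((Real.log (1 / δ) + 2 * ((k : ℝ) + 1)) / (2 * m))) =
        Real.log δ + -(2 * ((k : ℝ) + 1)) := by
      rw [one_div, Real.log_inv]; field_simp; ring
    rw [this, Real.exp_add, Real.exp_log hδ]
  have hBadk : ∀ k, μ.real (⋃ v ∈ N k, Bad k v) ≤ δ * (1 / 2) ^ (k + 1) := by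
    intro k
    have hgeom : 2 * Real.exp ((k : ℝ) / 2) * Real.exp (-(2 * ((k : ℝ) + 1))) ≤
        (1 / 2) ^ (k + 1) := by
      have h2 : (2 : ℝ) ≤ Real.exp 1 := by linarith [Real.add_one_le_exp 1]
      have h3 : Real.exp (-1) ≤ 1 / 2 := by
        rw [Real.exp_neg, ← one_div]
        exact one_div_le_one_div_of_le two_pos h2
      calc 2 * Real.exp ((k : ℝ) / 2) * Real.exp (-(2 * ((k : ℝ) + 1)))
          ≤ Real.exp 1 * Real.exp ((k : ℝ) / 2) * Real.exp (-(2 * ((k : ℝ) + 1))) := by gcongr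
        _ = Real.exp (1 + (k : ℝ) / 2 + -(2 * ((k : ℝ) + 1))) := by
            rw [Real.exp_add, Real.exp_add]
        _ ≤ Real.exp (((k + 1 : ℕ) : ℝ) * (-1)) := by
            rw [Real.exp_le_exp]
            push_cast
            linarith [Nat.cast_nonneg (α := ℝ) k]
        _ = Real.exp (-1) ^ (k + 1) := Real.exp_nat_mul _ _
        _ ≤ (1 / 2) ^ (k + 1) := pow_le_pow_left₀ (Real.exp_pos _).le h3 _
    calc μ.real (⋃ v ∈ N k, Bad k v) ≤ ∑ v ∈ N k, μ.real (Bad k v) :=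
          measureReal_biUnion_finset_le _ _
      _ ≤ ∑ _v ∈ N k, δ * Real.exp (-(2 * ((k : ℝ) + 1))) := by
          refine Finset.sum_le_sum fun v hv => ?_
          rw [← hexp]
          exact measure_empFreq_add_le hm (hA k v hv) (Real.sqrt_nonneg _)
      _ = (N k).card * (δ * Real.exp (-(2 * ((k : ℝ) + 1)))) := by
          rw [Finset.sum_const, nsmul_eq_mul]
      _ ≤ 2 * Real.exp ((k : ℝ) / 2) * (δ * Real.exp (-(2 * ((k : ℝ) + 1)))) :=
          mul_le_mul_of_nonneg_right (hN k) (by positivity)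
      _ = δ * (2 * Real.exp ((k : ℝ) / 2) * Real.exp (-(2 * ((k : ℝ) + 1)))) := by ring
      _ ≤ δ * (1 / 2) ^ (k + 1) := mul_le_mul_of_nonneg_left hgeom hδ.le
  have hmeas : MeasurableSet (⋃ k, ⋃ v ∈ N k, Bad k v) :=
    MeasurableSet.iUnion fun k => (N k).measurableSet_biUnion fun v hv =>
      measurableSet_empFreq_add_le (hA k v hv) _
  have hsum : HasSum (fun k : ℕ => δ * (1 / 2 : ℝ) ^ (k + 1)) δ := by
    have h := (hasSum_geometric_two).mul_left (δ * (1 / 2))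
    have e1 : δ * (1 / 2) * 2 = δ := by ring
    have e2 : (fun k : ℕ => δ * (1 / 2 : ℝ) ^ (k + 1)) = fun k => δ * (1 / 2) * (1 / 2) ^ k := by
      funext k; ring
    rw [e2]
    rwa [e1] at h
  have hBad : μ.real (⋃ k, ⋃ v ∈ N k, Bad k v) ≤ δ := by
    have h1 : μ (⋃ k, ⋃ v ∈ N k, Bad k v) ≤ ∑' k, ENNReal.ofReal (δ * (1 / 2) ^ (k + 1)) := by
      refine (measure_iUnion_le _).trans (ENNReal.tsum_le_tsum fun k => ?_)
      rw [← ofReal_measureReal (measure_ne_top _ _)]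
      exact ENNReal.ofReal_le_ofReal (hBadk k)
    rw [← ENNReal.ofReal_tsum_of_nonneg (fun k => by positivity) hsum.summable,
      hsum.tsum_eq] at h1
    exact ENNReal.toReal_le_of_le_ofReal hδ.le h1
  refine ⟨(⋃ k, ⋃ v ∈ N k, Bad k v)ᶜ, hmeas.compl, ?_, ?_⟩
  · rw [probReal_compl_eq_one_sub hmeas]
    linarith
  · intro S hS k v hv
    by_contra! hcon
    exact hS (Set.mem_iUnion.2 ⟨k, Set.mem_iUnion₂.2 ⟨v, hv, hcon.le⟩⟩)

end Concentration

/-! ### The smallest spectral norm. -/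

section Zeta

variable {r : ℕ} {d : ℕ → ℕ}

lemma zeta_le_W (w : Weights r d) (k : Fin (r + 1)) : zeta w ≤ specNorm (w.W k) :=
  (min_le_left _ _).trans
    (ciInf_le (f := fun k => specNorm (w.W k)) (Set.finite_range _).bddBelow k)

lemma zeta_le_U (w : Weights r d) (k : Fin r) : zeta w ≤ specNorm (w.U k) :=
  (min_le_right _ _).trans
    (ciInf_le (f := fun k => specNorm (w.U k)) (Set.finite_range _).bddBelow k)

lemma normSq_nonneg (w : Weights r d) : 0 ≤ normSq w := by
  rw [normSq_eq]; positivity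

lemma sq_zeta_le_normSq {w : Weights r d} (hζ : 0 < zeta w) : zeta w ^ 2 ≤ normSq w := by
  have h1 : zeta w ^ 2 ≤ frobSq (w.W 0) := by
    rw [← sq_frob]
    exact pow_le_pow_left₀ hζ.le ((zeta_le_W w 0).trans (specNorm_le_frob _)) 2
  have h2 : frobSq (w.W 0) ≤ ∑ k, frobSq (w.W k) :=
    Finset.single_le_sum (f := fun k => frobSq (w.W k)) (fun _ _ => frobSq_nonneg _)
      (Finset.mem_univ 0)
  have h3 : 0 ≤ ∑ k, frobSq (w.U k) := Finset.sum_nonneg fun _ _ => frobSq_nonneg _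
  unfold normSq
  linarith

/-- Keeps the complexity term bounded below, so that additive constants can be absorbed into it. -/
lemma one_le_inv_zeta_sq_mul_normSq {w : Weights r d} (hζ : 0 < zeta w) :
    1 ≤ (zeta w)⁻¹ ^ 2 * normSq w := by
  rw [inv_pow, inv_mul_eq_div, one_le_div (by positivity)]
  exact sq_zeta_le_normSq hζ

end Zeta

/-! ### Choice of the constants. -/

section Numerics

lemma one_le_log_of_four_le {x : ℝ} (hx : 4 ≤ x) : 1 ≤ Real.log x := by
  rw [Real.le_log_iff_exp_le (by linarith)]
  linarith [Real.exp_one_lt_d9]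

lemma four_le_mul {l h : ℕ} (hl : 2 ≤ l) (hh : 2 ≤ h) : (4 : ℝ) ≤ l * h := by
  have : 4 ≤ l * h := Nat.mul_le_mul hl hh
  exact_mod_cast this

lemma two_le_mul_log {l h : ℕ} (hl : 2 ≤ l) (hh : 2 ≤ h) : (2 : ℝ) ≤ h * Real.log (l * h) := by
  have h1 := one_le_log_of_four_le (four_le_mul hl hh)
  have h2 : (2 : ℝ) ≤ h := by exact_mod_cast hh
  nlinarith

/-- With `y = l h ≥ 4`, the constant `160 = 5 * 32` makes the exponential equal to `y^(-5 h)`. The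
factor `y^(4 h)` absorbs `25 ^ h`, and `y^h ≥ y²` absorbs the number of matrices. -/
lemma gaussian_failure_le {r h : ℕ} (hr : 1 ≤ r) (hh : 2 ≤ h) :
    2 * ((2 * (r : ℝ) + 1) * (25 ^ h * Real.exp (-
      (√(160 * (h * Real.log (((r + 1 : ℕ) : ℝ) * h))) ^ 2 / 32)))) ≤ 1 := by
  have hy : (4 : ℝ) ≤ ((r + 1 : ℕ) : ℝ) * h := four_le_mul (by omega) hh
  have h2 : (2 : ℝ) ≤ h := by exact_mod_cast hh
  have hpos := two_le_mul_log (l := r + 1) (by omega) hh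
  have hl : (r : ℝ) + 1 ≤ ((r + 1 : ℕ) : ℝ) * h := by
    push_cast
    nlinarith [Nat.cast_nonneg (α := ℝ) r]
  set y : ℝ := ((r + 1 : ℕ) : ℝ) * h with hydef
  rw [Real.sq_sqrt (by positivity)]
  have hexp : Real.exp (160 * (h * Real.log y) / 32) = y ^ h * (y ^ 4) ^ h := by
    have : 160 * (h * Real.log y) / 32 = ((5 * h : ℕ) : ℝ) * Real.log y := by push_cast; ring
    rw [this, Real.exp_nat_mul, Real.exp_log (by linarith), ← pow_mul, ← pow_add]
    congr 1; ring
  rw [Real.exp_neg, hexp]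
  have h3 : y ^ 2 ≤ y ^ h := pow_le_pow_right₀ (by linarith) hh
  have h4 : (25 : ℝ) ^ h ≤ (y ^ 4) ^ h := by
    refine pow_le_pow_left₀ (by norm_num) ?_ _
    calc (25 : ℝ) ≤ 4 ^ 4 := by norm_num
      _ ≤ y ^ 4 := pow_le_pow_left₀ (by norm_num) hy 4
  have h5 : 2 * (2 * (r : ℝ) + 1) ≤ y ^ h := by nlinarith
  have hyh : 0 < y ^ h := by positivity
  have hy4 : 0 < (y ^ 4) ^ h := by positivity
  calc _ = (2 * (2 * (r : ℝ) + 1) * 25 ^ h) / (y ^ h * (y ^ 4) ^ h) := by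
        rw [div_eq_mul_inv]; ring
    _ ≤ 1 := by
        rw [div_le_one (by positivity)]
        exact mul_le_mul h5 h4 (by positivity) hyh.le

/-- The deviation term at the resolution `s` is of the order of the complexity term. -/
lemma sqrt_deviation_le {M₁ M₂ G ξ b H T s γ l ζ W Q Λ m : ℝ} (hM₁ : 0 < M₁) (hM₂ : 0 < M₂)
    (hl : 2 ≤ l) (hG : 0 < G) (hξ : ξ = G * (M₁ * M₂)) (hb : 0 < b) (hH : 2 ≤ H)
    (hT : T = G * (M₂ + l * M₁) * b) (hs : s = γ / (4 * T) / (2 * √(160 * H))) (hγ : 0 < γ)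
    (hsmall : γ < 2 * (ξ * b)) (hζ : 0 < ζ) (hζ₁ : ζ ≤ M₁) (hζ₂ : ζ ≤ M₂) (hW : 0 ≤ W)
    (hζW : 1 ≤ ζ⁻¹ ^ 2 * W) (hQ : Q = l ^ 2 * ξ ^ 2 * b ^ 2 * H * (ζ⁻¹ ^ 2 * W)) (hΛ : 0 < Λ)
    (hm : 0 < m) :
    √((Λ + 2 * ((⌈W / s ^ 2⌉₊ : ℝ) + 1)) / (2 * m)) ≤
      300 * √((Q + max 1 (γ ^ 2) * Λ) / (γ ^ 2 * m)) := by
  have hH0 : 0 < H := by linarith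
  have hl0 : 0 < l := by linarith
  have hξ0 : 0 < ξ := by rw [hξ]; positivity
  have hTpos : 0 < T := by rw [hT]; positivity
  -- Here `γ < 2 ξ b` enters: it lets `Q` absorb the `+ 1` terms, including the rounding of the
  -- budget.
  have hQγ : 2 * γ ^ 2 ≤ Q := by
    have h1 : γ ^ 2 ≤ 4 * (ξ ^ 2 * b ^ 2) := by
      have := pow_le_pow_left₀ hγ.le hsmall.le 2
      linarith
    have h3 : 8 * (ξ ^ 2 * b ^ 2) ≤ l ^ 2 * ξ ^ 2 * b ^ 2 * H := by
      have h4 : 8 ≤ l ^ 2 * H := by nlinarith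
      have h5 := mul_le_mul_of_nonneg_right h4 (show 0 ≤ ξ ^ 2 * b ^ 2 by positivity)
      linarith
    rw [hQ]
    have h6 := mul_le_mul_of_nonneg_left hζW (show 0 ≤ l ^ 2 * ξ ^ 2 * b ^ 2 * H by positivity)
    linarith
  have hTle : T ^ 2 * H ≤ 4 * (l ^ 2 * ξ ^ 2 * b ^ 2 * H) * ζ⁻¹ ^ 2 := by
    -- Since `ζ ≤ M₁` and `ζ ≤ M₂`, each of `M₁` and `M₂` is at most `M₁ M₂ / ζ`; this replaces the
    -- perturbation constant by `ξ / ζ`.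
    have h1 : M₂ + l * M₁ ≤ 2 * l * (M₁ * M₂) * ζ⁻¹ := by
      rw [← div_eq_mul_inv, le_div_iff₀ hζ]
      have h5 : M₂ * ζ ≤ l * (M₁ * M₂) := by
        have : M₂ * ζ ≤ M₁ * M₂ := by nlinarith
        nlinarith [mul_pos hM₁ hM₂]
      have h6 : l * M₁ * ζ ≤ l * (M₁ * M₂) := by
        rw [mul_assoc]
        gcongr
      linarith
    have h7 : T ≤ 2 * l * ξ * ζ⁻¹ * b := by
      calc T ≤ G * (2 * l * (M₁ * M₂) * ζ⁻¹) * b := by rw [hT]; gcongr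
        _ = _ := by rw [hξ]; ring
    have h8 := mul_le_mul_of_nonneg_right (pow_le_pow_left₀ hTpos.le h7 2) hH0.le
    exact h8.trans_eq (by ring)
  have hk1 : (⌈W / s ^ 2⌉₊ : ℝ) * γ ^ 2 ≤ 40960 * Q + γ ^ 2 := by
    have h1 : (⌈W / s ^ 2⌉₊ : ℝ) < W / s ^ 2 + 1 := Nat.ceil_lt_add_one (by positivity)
    -- `10240 = (4 * 2)² * 160`, read off from the formula for `s`.
    have h2 : W / s ^ 2 * γ ^ 2 = 10240 * (W * (T ^ 2 * H)) := by
      have h3 : √(160 * H) ^ 2 = 160 * H := Real.sq_sqrt (by positivity)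
      rw [hs, div_pow, mul_pow, h3, div_pow, mul_pow]
      field_simp
      ring
    have h4 := mul_le_mul_of_nonneg_left hTle hW
    have h5 := mul_lt_mul_of_pos_right h1 (show 0 < γ ^ 2 by positivity)
    rw [hQ]
    linarith
  have h300 : (300 : ℝ) = √90000 := by
    rw [show (90000 : ℝ) = 300 ^ 2 by norm_num, Real.sqrt_sq (by norm_num)]
  rw [h300, ← Real.sqrt_mul (by norm_num)]
  refine Real.sqrt_le_sqrt ?_
  rw [← mul_div_assoc, div_le_div_iff₀ (by positivity) (by positivity)]
  have hfin : (Λ + 2 * ((⌈W / s ^ 2⌉₊ : ℝ) + 1)) * γ ^ 2 ≤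
      90000 * (Q + max 1 (γ ^ 2) * Λ) * 2 := by
    have h1 := mul_le_mul_of_nonneg_right (le_max_right 1 (γ ^ 2)) hΛ.le
    have h2 : 0 ≤ γ ^ 2 * Λ := by positivity
    have h3 : 0 < γ ^ 2 := by positivity
    linarith
  calc (Λ + 2 * ((⌈W / s ^ 2⌉₊ : ℝ) + 1)) * (γ ^ 2 * m)
      = (Λ + 2 * ((⌈W / s ^ 2⌉₊ : ℝ) + 1)) * γ ^ 2 * m := by ring
    _ ≤ 90000 * (Q + max 1 (γ ^ 2) * Λ) * 2 * m := mul_le_mul_of_nonneg_right hfin hm.le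
    _ = _ := by ring

end Numerics

/-! ### The uniform generalization bound. -/

section Generalization

variable {n r h : ℕ} {d : ℕ → ℕ} {act : Activations r} {L : ℝ≥0}
  {M₁ M₂ p B ε γ δ : ℝ}
  {P : Matrix (Fin n) (Fin n) ℝ → Matrix (Fin n) (Fin n) ℝ}
  {𝒢 : Set (Matrix (Fin n) (Fin n) ℝ)}
  {D : Measure (Sample n (d 0) (d (r + 1)))} [IsProbabilityMeasure D]

lemma robustLoss_le_one (w : Weights r d) : robustLoss ε 𝒢 P act D γ w ≤ 1 :=
  measureReal_le_one

lemma empRobustLoss_eq_one {m : ℕ} (hm : 1 ≤ m) {S : Fin m → Sample n (d 0) (d (r + 1))}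
    {w : Weights r d} (h : ∀ i, robustMargin ε 𝒢 P act w (S i) ≤ γ) :
    empRobustLoss ε 𝒢 P act S γ w = 1 := by
  have hmpos : (m : ℝ) ≠ 0 := by positivity
  simp only [empRobustLoss, h, if_true, Finset.sum_const, Finset.card_univ, Fintype.card_fin,
    nsmul_eq_mul, mul_one]
  field_simp

/-- Training sets all of whose feature matrices have spectral norm at most `B`. -/
def boundedSamples (n r : ℕ) (d : ℕ → ℕ) (m : ℕ) (B : ℝ) :
    Set (Fin m → Sample n (d 0) (d (r + 1))) :=
  {S | ∀ i, specNorm (S i).1.1 ≤ B}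

lemma measurableSet_boundedSamples (m : ℕ) : MeasurableSet (boundedSamples n r d m B) := by
  have h : boundedSamples n r d m B = ⋂ i, {S | specNorm (S i).1.1 ≤ B} := by
    ext S; simp [boundedSamples]
  rw [h]
  refine MeasurableSet.iInter fun i => measurableSet_le ?_ measurable_const
  exact continuous_specNorm.measurable.comp
    (measurable_fst.comp (measurable_fst.comp (measurable_pi_apply i)))

lemma ae_boundedSamples (hB : ∀ᵐ z ∂D, specNorm z.1.1 ≤ B) (m : ℕ) :
    ∀ᵐ S ∂Measure.pi fun _ : Fin m => D, S ∈ boundedSamples n r d m B := by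
  refine ae_all_iff.2 fun i => ?_
  exact (measurePreserving_eval (fun _ : Fin m => D) i).quasiMeasurePreserving.ae hB

/-- The margin loss of `w` is controlled by the deviation of a nearby network `v`. -/
lemma robustLoss_le_of_close (hact : act.Admissible L) (hM₁ : 0 ≤ M₁) (hM₂ : 0 ≤ M₂)
    (hK : 2 ≤ d (r + 1)) (hP : ∀ A ∈ 𝒢, specNorm (P A) ≤ p) (hε : 0 ≤ ε) (h𝒢 : 𝒢.Nonempty)
    (hB : ∀ᵐ z ∂D, specNorm z.1.1 ≤ B) {w v : Weights r d} (hw : w.Bounded M₁ M₂)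
    (hv : v.Bounded M₁ M₂) {t : ℝ} (ht : 0 ≤ t)
    (hW : ∀ k, specNorm (w.W k - v.W k) ≤ t) (hU : ∀ k, specNorm (w.U k - v.U k) ≤ t)
    (hγ : 2 * (L * t * (M₂ + ((r + 1 : ℕ) : ℝ) * M₁) * geo (tau L M₂ p) r * (B + ε)) ≤ γ / 2)
    {m : ℕ} {S : Fin m → Sample n (d 0) (d (r + 1))} (hS : S ∈ boundedSamples n r d m B)
    {s : ℝ} (hdev : D.real {z | robustMargin ε 𝒢 P act v z ≤ γ / 2} ≤
      empFreq S {z | robustMargin ε 𝒢 P act v z ≤ γ / 2} + s) :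
    robustLoss ε 𝒢 P act D 0 w ≤ empRobustLoss ε 𝒢 P act S γ w + s := by
  obtain ⟨A, hA⟩ := id h𝒢
  have hp : 0 ≤ p := (specNorm_nonneg _).trans (hP A hA)
  have hg := geo_nonneg (tau_nonneg (L := L) hM₂ hp) r
  have hclose : ∀ z : Sample n (d 0) (d (r + 1)), specNorm z.1.1 ≤ B →
      2 * (L * t * (M₂ + ((r + 1 : ℕ) : ℝ) * M₁) * geo (tau L M₂ p) r *
        (specNorm z.1.1 + ε)) ≤ γ / 2 := fun z hz =>
    le_trans (by gcongr) hγ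
  -- The margins of `w` and `v` differ by at most `γ / 2`. A margin of `w` below `0` thus forces one
  -- of `v` below `γ / 2`, which in turn forces one of `w` below `γ`.
  have h1 : robustLoss ε 𝒢 P act D 0 w ≤ D.real {z | robustMargin ε 𝒢 P act v z ≤ γ / 2} := by
    refine ENNReal.toReal_mono (measure_ne_top _ _) (measure_mono_ae ?_)
    filter_upwards [hB] with z hz hz0
    have h2 := robustMargin_le_add_of_weights hact hM₁ hM₂ hK hP hε h𝒢 hv hw ht
      (fun k => by rw [← specNorm_neg, neg_sub]; exact hW k)
      (fun k => by rw [← specNorm_neg, neg_sub]; exact hU k) z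
    have h3 : robustMargin ε 𝒢 P act w z ≤ 0 := hz0
    exact (h2.trans (add_le_add h3 (hclose z hz))).trans_eq (zero_add _)
  have h2 : empFreq S {z | robustMargin ε 𝒢 P act v z ≤ γ / 2} ≤
      empRobustLoss ε 𝒢 P act S γ w := by
    classical
    refine mul_le_mul_of_nonneg_left (Finset.sum_le_sum fun i _ => ?_) (by positivity)
    by_cases hi : robustMargin ε 𝒢 P act v (S i) ≤ γ / 2
    · have h3 := robustMargin_le_add_of_weights hact hM₁ hM₂ hK hP hε h𝒢 hw hv ht hW hU (S i)
      have h4 : robustMargin ε 𝒢 P act w (S i) ≤ γ := by linarith [hclose (S i) (hS i)]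
      simp [h4, hi]
    · rw [if_neg (by exact hi)]
      split_ifs <;> norm_num
  linarith

/-- The complexity of `w` at scale `γ`: with `ξ = L M₁ M₂ (1 + τ + ⋯ + τ ^ (r - 1))`, this is
`l² ξ² ζ⁻² |w|₂² Ψ₀`. -/
def complexity (ξ : ℝ) (h : ℕ) (B ε : ℝ) (w : Weights r d) : ℝ :=
  ((r + 1 : ℕ) : ℝ) ^ 2 * ξ ^ 2 * (zeta w)⁻¹ ^ 2 * normSq w * Psi0 (r + 1) h B ε

/-- One event serves all `w`: the scale `s` is fixed in advance, and `w` only selects the budget `k`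
whose net is used. -/
lemma exists_generalization_event (hr : 1 ≤ r) (hd : ∀ k ≤ r + 1, d k ≤ h)
    (hact : act.Admissible L) (hM₁ : 0 < M₁) (hM₂ : 0 < M₂)
    (hK : 2 ≤ d (r + 1)) (hP : ∀ A ∈ 𝒢, specNorm (P A) ≤ p) (hε : 0 < ε) (h𝒢 : 𝒢.Nonempty)
    (hB0 : 0 ≤ B) (hB : ∀ᵐ z ∂D, specNorm z.1.1 ≤ B) (hγ : 0 < γ) (hδ : 0 < δ) (hδ1 : δ < 1)
    {m : ℕ} (hm : 1 ≤ m) :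
    ∃ E : Set (Fin m → Sample n (d 0) (d (r + 1))), MeasurableSet E ∧
      1 - δ ≤ (Measure.pi fun _ : Fin m => D).real E ∧
      ∀ S ∈ E, ∀ w : Weights r d, w.Bounded M₁ M₂ → 0 < zeta w →
        robustLoss ε 𝒢 P act D 0 w ≤ empRobustLoss ε 𝒢 P act S γ w +
          300 * √((complexity (L * M₁ * M₂ * geo (tau L M₂ p) r) h B ε w +
            max 1 (γ ^ 2) * Real.log (1 / δ)) / (γ ^ 2 * m)) := by
  set μ := Measure.pi fun _ : Fin m => D
  obtain ⟨A₀, hA₀⟩ := id h𝒢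
  have hp : 0 ≤ p := (specNorm_nonneg _).trans (hP A₀ hA₀)
  have hg := geo_nonneg (tau_nonneg (L := L) hM₂.le hp) r
  have hL : (0 : ℝ) ≤ L := L.coe_nonneg
  set g := geo (tau L M₂ p) r with hgdef
  set ξ : ℝ := L * M₁ * M₂ * g with hξ
  have hB' : 0 < B + ε := by linarith
  have hmpos : (0 : ℝ) < m := by exact_mod_cast hm
  have hh : 2 ≤ h := hK.trans (hd (r + 1) le_rfl)
  -- For large `γ` every robust margin on the sample is at most `γ`, so the empirical loss is `1`
  -- and the bound is trivial.
  rcases le_or_gt (2 * (ξ * (B + ε))) γ with hbig | hsmall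
  · refine ⟨boundedSamples n r d m B, measurableSet_boundedSamples m, ?_, fun S hS w hw _ => ?_⟩
    · have h1 : μ.real (boundedSamples n r d m B) = 1 :=
        (measureReal_congr (ae_eq_univ.2 (ae_boundedSamples hB m))).trans probReal_univ
      linarith
    · rw [empRobustLoss_eq_one hm fun i => ?_]
      · have h1 := robustLoss_le_one (ε := ε) (𝒢 := 𝒢) (P := P) (act := act) (D := D) (γ := 0) w
        have h2 := Real.sqrt_nonneg ((complexity ξ h B ε w +
            max 1 (γ ^ 2) * Real.log (1 / δ)) / (γ ^ 2 * m))
        linarith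
      · refine (robustMargin_le hact hM₁.le hM₂.le hK hP hε.le h𝒢 hw (S i)).trans
          (le_trans ?_ hbig)
        have := hS i
        gcongr
  have hξ0 : 0 < ξ := by
    by_contra! hcon
    have : ξ * (B + ε) ≤ 0 := mul_nonpos_of_nonpos_of_nonneg hcon hB'.le
    linarith
  have hLg : 0 < L * g := by
    have h1 : ξ = L * g * (M₁ * M₂) := by rw [hξ]; ring
    rw [h1] at hξ0
    exact pos_of_mul_pos_left hξ0 (by positivity)
  have hlog := two_le_mul_log (l := r + 1) (by omega) hh
  set H : ℝ := h * Real.log (((r + 1 : ℕ) : ℝ) * h) with hH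
  set T : ℝ := L * g * (M₂ + ((r + 1 : ℕ) : ℝ) * M₁) * (B + ε) with hT
  have hTpos : 0 < T := by positivity
  -- The perturbation bound `2 t T` then equals the allowed `γ / 2`.
  set t : ℝ := γ / (4 * T) with ht
  have htpos : 0 < t := by positivity
  set t₀ : ℝ := √(160 * H) with ht₀
  have ht₀pos : 0 < t₀ := Real.sqrt_pos.2 (by positivity)
  -- The net has accuracy `2 s t₀`, which becomes `t`.
  set s : ℝ := t / (2 * t₀) with hs
  have hspos : 0 < s := by positivity
  have hst : 2 * s * t₀ = t := by rw [hs]; field_simp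
  choose N hNcard hNb hNnet using fun k : ℕ =>
    exists_weights_net (r := r) hd ht₀pos.le (gaussian_failure_le hr hh) hspos M₁ M₂ (k : ℝ)
  obtain ⟨E, hE, hEmass, hEdev⟩ := exists_uniform_event (D := D) hm hδ hδ1 N hNcard
    (fun v => {z | robustMargin ε 𝒢 P act (Weights.ofVec (s • v)) z ≤ γ / 2})
    fun k v hv => measurableSet_robustMargin_le hact hM₁.le hM₂.le hK hP hε.le h𝒢 (hNb k v hv) _
  refine ⟨E ∩ boundedSamples n r d m B, hE.inter (measurableSet_boundedSamples m), ?_,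
    fun S hS w hw hζ => ?_⟩
  · have h1 : μ.real (E ∩ boundedSamples n r d m B) = μ.real E :=
      measureReal_congr (inter_ae_eq_left_of_ae_eq_univ (ae_eq_univ.2 (ae_boundedSamples hB m)))
    rw [h1]
    exact hEmass
  set k := ⌈normSq w / s ^ 2⌉₊ with hk
  have hwk : normSq w ≤ s ^ 2 * k := by
    have := Nat.le_ceil (normSq w / s ^ 2)
    rwa [div_le_iff₀ (by positivity), mul_comm] at this
  obtain ⟨v, hv, hvW, hvU⟩ := hNnet k w hw hwk
  rw [hst] at hvW hvU
  have hclose : 2 * (L * t * (M₂ + ((r + 1 : ℕ) : ℝ) * M₁) * g * (B + ε)) ≤ γ / 2 := by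
    have h1 : L * t * (M₂ + ((r + 1 : ℕ) : ℝ) * M₁) * g * (B + ε) = t * T := by rw [hT]; ring
    have h2 : t * T = γ / 4 := by rw [ht]; field_simp
    rw [h1, h2]
    linarith
  refine (robustLoss_le_of_close hact hM₁.le hM₂.le hK hP hε.le h𝒢 hB hw (hNb k v hv) htpos.le
    hvW hvU hclose hS.2 (hEdev S hS.1 k v hv)).trans ?_
  refine add_le_add le_rfl ?_
  have hl : (2 : ℝ) ≤ ((r + 1 : ℕ) : ℝ) := by exact_mod_cast Nat.succ_le_succ hr
  have hΛ : 0 < Real.log (1 / δ) := Real.log_pos (by rw [lt_div_iff₀ hδ]; linarith)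
  refine sqrt_deviation_le hM₁ hM₂ hl hLg (by rw [hξ]; ring) hB' hlog hT rfl hγ hsmall hζ
    ((zeta_le_U w ⟨0, hr⟩).trans (hw.2 ⟨0, hr⟩)) ((zeta_le_W w 0).trans (hw.1 0))
    (normSq_nonneg w) (one_le_inv_zeta_sq_mul_normSq hζ) ?_ hΛ hmpos
  rw [complexity, Psi0]
  ring

end Generalization

/-! ### Comparison with the stated complexity terms. -/

section MainTerms

variable {r : ℕ} {d : ℕ → ℕ}

lemma geo_one (k : ℕ) : geo 1 k = k := by simp [geo]

lemma xi_eq (r : ℕ) (L M₁ M₂ : ℝ) {τ : ℝ} (hτ : τ ≠ 1) :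
    xi (r + 1) L M₁ M₂ τ = L * M₁ * M₂ * geo τ r := by
  rw [xi, geo, geom_sum_eq hτ, Nat.add_sub_cancel]

lemma Psi0_nonneg {l h : ℕ} (hl : 2 ≤ l) (hh : 2 ≤ h) (B ε : ℝ) : 0 ≤ Psi0 l h B ε := by
  have h1 := two_le_mul_log hl hh
  rw [Psi0, mul_assoc]
  positivity

lemma sq_mul_sq_le_max {x a : ℝ} (ha : 0 ≤ a) :
    x ^ 2 * a ^ 2 ≤ max (x ^ 6) (a ^ 3) := by
  rcases le_total a (x ^ 2) with h | h
  · refine le_trans ?_ (le_max_left _ _)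
    calc x ^ 2 * a ^ 2 ≤ x ^ 2 * (x ^ 2) ^ 2 := by gcongr
      _ = x ^ 6 := by ring
  · refine le_trans ?_ (le_max_right _ _)
    calc x ^ 2 * a ^ 2 ≤ a * a ^ 2 := by gcongr
      _ = a ^ 3 := by ring

/-- For `τ = 1` the geometric sum is `r = l - 1`, and `l² r² ≤ (l + 1)⁴`. With `a = L M₁ M₂`, the
product `ζ⁻² a²` is at most the cube of the larger of `ζ⁻²` and `a`. -/
lemma complexity_le_Psi1 {h : ℕ} (hr : 1 ≤ r) (hh : 2 ≤ h) {L M₁ M₂ : ℝ}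
    (hL : 0 ≤ L * M₁ * M₂) (B ε : ℝ) {w : Weights r d} (hζ : 0 < zeta w) :
    complexity (L * M₁ * M₂ * geo 1 r) h B ε w ≤
      (((r + 1 : ℕ) : ℝ) + 1) ^ 4 * Psi0 (r + 1) h B ε * Psi1 L M₁ M₂ w := by
  have h1 := sq_mul_sq_le_max (x := (zeta w)⁻¹) hL
  have hΨ := Psi0_nonneg (l := r + 1) (by omega) hh B ε
  have hw := normSq_nonneg w
  have h2 : ((r + 1 : ℕ) : ℝ) ^ 2 * (r : ℝ) ^ 2 ≤ (((r + 1 : ℕ) : ℝ) + 1) ^ 4 := by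
    push_cast
    have hr0 : (0 : ℝ) ≤ r := Nat.cast_nonneg r
    calc ((r : ℝ) + 1) ^ 2 * (r : ℝ) ^ 2 ≤ ((r : ℝ) + 1 + 1) ^ 2 * ((r : ℝ) + 1 + 1) ^ 2 := by
          gcongr <;> linarith
      _ = _ := by ring
  rw [complexity, Psi1, geo_one]
  calc ((r + 1 : ℕ) : ℝ) ^ 2 * (L * M₁ * M₂ * r) ^ 2 * (zeta w)⁻¹ ^ 2 * normSq w *
        Psi0 (r + 1) h B ε
      = (((r + 1 : ℕ) : ℝ) ^ 2 * (r : ℝ) ^ 2) * Psi0 (r + 1) h B ε *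
        (((zeta w)⁻¹ ^ 2 * (L * M₁ * M₂) ^ 2) * normSq w) := by ring
    _ ≤ _ := by gcongr

/-- If `X` is the maximum in `Psi2`, then `ζ⁻¹ ≤ X` and `ξ ≤ X^l`, so `ξ² ζ⁻² ≤ X^(2 l + 2)`. -/
lemma complexity_le_Psi2 {h : ℕ} (hr : 1 ≤ r) (hh : 2 ≤ h) {ξ : ℝ}
    (hξ : 0 ≤ ξ) (B ε : ℝ) {w : Weights r d} (hζ : 0 < zeta w) :
    complexity ξ h B ε w ≤
      ((r + 1 : ℕ) : ℝ) ^ 2 * Psi0 (r + 1) h B ε * Psi2 ξ w := by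
  have hΨ := Psi0_nonneg (l := r + 1) (by omega) hh B ε
  have hw := normSq_nonneg w
  rw [complexity, Psi2]
  set X := max (zeta w)⁻¹ (ξ ^ (1 / ((r + 1 : ℕ) : ℝ))) with hX
  have h1 : (zeta w)⁻¹ ≤ X := le_max_left _ _
  have h2 : ξ ≤ X ^ (r + 1) := by
    calc ξ = (ξ ^ (1 / ((r + 1 : ℕ) : ℝ))) ^ (r + 1) := by
          rw [one_div, Real.rpow_inv_natCast_pow hξ (Nat.succ_ne_zero r)]
      _ ≤ X ^ (r + 1) := pow_le_pow_left₀ (Real.rpow_nonneg hξ _) (le_max_right _ _) _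
  calc ((r + 1 : ℕ) : ℝ) ^ 2 * ξ ^ 2 * (zeta w)⁻¹ ^ 2 * normSq w * Psi0 (r + 1) h B ε
      = ((r + 1 : ℕ) : ℝ) ^ 2 * Psi0 (r + 1) h B ε * (ξ ^ 2 * (zeta w)⁻¹ ^ 2 * normSq w) := by
        ring
    _ ≤ ((r + 1 : ℕ) : ℝ) ^ 2 * Psi0 (r + 1) h B ε * ((X ^ (r + 1)) ^ 2 * X ^ 2 * normSq w) := by
        gcongr
    _ = _ := by rw [← pow_mul, ← pow_add, Nat.mul_comm (r + 1) 2]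

lemma geo_le {τ : ℝ} (hτ : 0 ≤ τ) (r : ℕ) : geo τ r ≤ r * max 1 τ ^ (r - 1) := by
  calc geo τ r ≤ ∑ _i ∈ Finset.range r, max 1 τ ^ (r - 1) := by
        refine Finset.sum_le_sum fun i hi => ?_
        have hi' : i ≤ r - 1 := Nat.le_sub_one_of_lt (Finset.mem_range.1 hi)
        calc τ ^ i ≤ max 1 τ ^ i := pow_le_pow_left₀ hτ (le_max_right _ _) i
          _ ≤ max 1 τ ^ (r - 1) := pow_le_pow_right₀ (le_max_left _ _) hi'
    _ = r * max 1 τ ^ (r - 1) := by simp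

/-- The dependence of the main term on the largest spectral norm `p` of the graph matrices. -/
lemma sqrt_main_term_le {h : ℕ} (hr : 1 ≤ r) (hh : 2 ≤ h) {L M₁ M₂ p B ε : ℝ}
    (hL : 0 ≤ L) (hM₁ : 0 ≤ M₁) (hM₂ : 0 ≤ M₂) (hp : 0 ≤ p) (hB : 0 ≤ B + ε)
    {w : Weights r d} (hζ : 0 < zeta w) :
    √(((r + 1 : ℕ) : ℝ) ^ 2 * Psi0 (r + 1) h B ε *
        Psi2 (L * M₁ * M₂ * geo (tau L M₂ p) r) w) ≤
      (B + ε) * √(normSq w) *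
        max (zeta w)⁻¹ ((L * M₁ * M₂ * (((r + 1 : ℕ) : ℝ) - 1) *
          max 1 (L ^ 3 * M₂) ^ (r + 1 - 2)) ^ (1 / ((r + 1 : ℕ) : ℝ))) ^ (r + 1 + 1) *
        (max 1 p ^ ((((r + 1 : ℕ) : ℝ) - 2) * (((r + 1 : ℕ) : ℝ) + 1) / ((r + 1 : ℕ) : ℝ)) *
          ((r + 1 : ℕ) : ℝ) * √(h * Real.log (((r + 1 : ℕ) : ℝ) * h))) := by
  have hH := two_le_mul_log (l := r + 1) (by omega) hh
  have hw := normSq_nonneg w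
  have hτ : 0 ≤ tau L M₂ p := by unfold tau; positivity
  have hg := geo_nonneg hτ r
  set l : ℝ := ((r + 1 : ℕ) : ℝ) with hl
  have hl0 : 0 < l := by positivity
  have hlr : l = r + 1 := by rw [hl]; push_cast; ring
  set ξ := L * M₁ * M₂ * geo (tau L M₂ p) r with hξ
  set c := L * M₁ * M₂ * (l - 1) * max 1 (L ^ 3 * M₂) ^ (r + 1 - 2) with hc
  set X := max (zeta w)⁻¹ (ξ ^ (1 / l)) with hX
  set Y := max (zeta w)⁻¹ (c ^ (1 / l)) with hY
  set H := (h : ℝ) * Real.log (l * h) with hHdef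
  have hζi : 0 < (zeta w)⁻¹ := inv_pos.2 hζ
  have hX0 : 0 < X := hζi.trans_le (le_max_left _ _)
  have hY0 : 0 < Y := hζi.trans_le (le_max_left _ _)
  have hr0 : (0 : ℝ) ≤ l - 1 := by rw [hlr]; simp
  have hc0 : 0 ≤ c := by positivity
  have hξ0 : 0 ≤ ξ := by positivity
  have hp1 : 1 ≤ max 1 p := le_max_left _ _
  have hlhs : l ^ 2 * Psi0 (r + 1) h B ε * Psi2 ξ w =
      (l * (B + ε) * √H * √(normSq w) * X ^ (r + 1 + 1)) ^ 2 := by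
    have e : (l * (B + ε) * √H * √(normSq w) * X ^ (r + 1 + 1)) ^ 2 =
        l ^ 2 * (B + ε) ^ 2 * √H ^ 2 * √(normSq w) ^ 2 * (X ^ (r + 1 + 1)) ^ 2 := by ring
    rw [e, Real.sq_sqrt (by positivity), Real.sq_sqrt hw, ← pow_mul, Psi0, Psi2]
    have e2 : (r + 1 + 1) * 2 = 2 * (r + 1) + 2 := by ring
    rw [e2]
    ring
  rw [hlhs, Real.sqrt_sq (by positivity)]
  have hmax : max 1 (tau L M₂ p) ≤ max 1 (L ^ 3 * M₂) * max 1 p := by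
    refine max_le (one_le_mul_of_one_le_of_one_le (le_max_left _ _) hp1) ?_
    exact mul_le_mul (le_max_right _ _) (le_max_right _ _) hp (by positivity)
  -- The geometric sum has `r = l - 1` terms with powers up to `r - 1 = l - 2`. The `l`-th root and
  -- the power `l + 1` then produce the exponent `(l - 2) (l + 1) / l`.
  have hξc : ξ ≤ c * max 1 p ^ (r - 1) := by
    have h1 : geo (tau L M₂ p) r ≤ r * (max 1 (L ^ 3 * M₂) * max 1 p) ^ (r - 1) :=
      (geo_le hτ r).trans (by gcongr)
    have h2 : r + 1 - 2 = r - 1 := by omega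
    calc ξ ≤ L * M₁ * M₂ * (r * (max 1 (L ^ 3 * M₂) * max 1 p) ^ (r - 1)) := by
          rw [hξ]; gcongr
      _ = c * max 1 p ^ (r - 1) := by rw [hc, hlr, h2, mul_pow]; ring
  have hpow : ξ ^ (1 / l) ≤ c ^ (1 / l) * max 1 p ^ ((l - 2) / l) := by
    calc ξ ^ (1 / l) ≤ (c * max 1 p ^ (r - 1)) ^ (1 / l) :=
          Real.rpow_le_rpow hξ0 hξc (by positivity)
      _ = c ^ (1 / l) * max 1 p ^ ((l - 2) / l) := by
          rw [Real.mul_rpow hc0 (by positivity), ← Real.rpow_natCast, ← Real.rpow_mul (by positivity)]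
          congr 2
          rw [Nat.cast_sub hr, hlr]
          push_cast
          ring
  have hexp : 0 ≤ (l - 2) / l := by
    have : (1 : ℝ) ≤ r := by exact_mod_cast hr
    exact div_nonneg (by rw [hlr]; linarith) hl0.le
  have hXY : X ≤ Y * max 1 p ^ ((l - 2) / l) := by
    have h1 : 1 ≤ max 1 p ^ ((l - 2) / l) := Real.one_le_rpow hp1 hexp
    refine max_le ?_ (hpow.trans (by gcongr; exact le_max_right _ _))
    calc (zeta w)⁻¹ ≤ Y := le_max_left _ _
      _ ≤ Y * max 1 p ^ ((l - 2) / l) := le_mul_of_one_le_right hY0.le h1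
  have hfin : X ^ (r + 1 + 1) ≤ Y ^ (r + 1 + 1) * max 1 p ^ ((l - 2) * (l + 1) / l) := by
    calc X ^ (r + 1 + 1) ≤ (Y * max 1 p ^ ((l - 2) / l)) ^ (r + 1 + 1) :=
          pow_le_pow_left₀ hX0.le hXY _
      _ = Y ^ (r + 1 + 1) * max 1 p ^ ((l - 2) * (l + 1) / l) := by
          rw [mul_pow, ← Real.rpow_natCast (max 1 p ^ ((l - 2) / l)),
            ← Real.rpow_mul (by positivity)]
          congr 2
          rw [hlr]
          push_cast
          ring
  calc l * (B + ε) * √H * √(normSq w) * X ^ (r + 1 + 1)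
      ≤ l * (B + ε) * √H * √(normSq w) *
        (Y ^ (r + 1 + 1) * max 1 p ^ ((l - 2) * (l + 1) / l)) := by gcongr
    _ = _ := by ring

end MainTerms

end MPGNN

end

/-! ### The theorem. -/

theorem theorem2 :
    -- the constant behind the O-symbols is absolute
    ∃ C : ℝ, 0 < C ∧
    -- `r ≥ 1` message-passing layers and a readout: depth `l = r + 1 ≥ 2`; widths `d 0, …, d l`
    ∀ (n r : ℕ) (d : ℕ → ℕ) (l h : ℕ), 1 ≤ r → l = r + 1 →
      (∀ k ≤ l, d k ≤ h) → 2 ≤ d (r + 1) →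
    -- admissible features and adjacency matrices, graph matrix `P_G = P A`
    ∀ (B : ℝ) (𝒳 : Set (Matrix (Fin n) (Fin (d 0)) ℝ))
      (𝒢 : Set (Matrix (Fin n) (Fin n) ℝ))
      (P : Matrix (Fin n) (Fin n) ℝ → Matrix (Fin n) (Fin n) ℝ),
      (∀ X ∈ 𝒳, specNorm X ≤ B) →
      BddAbove ((fun A => specNorm (P A)) '' 𝒢) →
    ∀ (L : ℝ≥0) (act : Activations r), act.Admissible L →
    ∀ (M₁ M₂ p τ ξ ε γ δ : ℝ), p = maxSpec 𝒢 P → τ = tau L M₂ p → ξ = xi l L M₁ M₂ τ →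
      0 < ε → 0 < γ → 0 < δ →
    -- the data distribution
    ∀ (D : Measure (Sample n (d 0) (d (r + 1)))) [IsProbabilityMeasure D],
      (∀ᵐ z ∂D, z.1.1 ∈ 𝒳 ∧ z.1.2 ∈ 𝒢) →
    ∀ m : ℕ, 1 ≤ m →
    (∃ E : Set (Fin m → Sample n (d 0) (d (r + 1))), MeasurableSet E ∧
      1 - δ ≤ (Measure.pi fun _ : Fin m => D).real E ∧
      ∀ S ∈ E, ∀ w : Weights r d, w.Bounded M₁ M₂ → 0 < zeta w →
        (τ = 1 →
          robustLoss ε 𝒢 P act D 0 w ≤ empRobustLoss ε 𝒢 P act S γ w +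
            C * √((((l : ℝ) + 1) ^ 4 * Psi0 l h B ε * Psi1 L M₁ M₂ w +
              max 1 (γ ^ 2) * Real.log (m / δ)) / (γ ^ 2 * m))) ∧
        (τ ≠ 1 →
          robustLoss ε 𝒢 P act D 0 w ≤ empRobustLoss ε 𝒢 P act S γ w +
            C * √(((l : ℝ) ^ 2 * Psi0 l h B ε * Psi2 ξ w +
              max 1 (γ ^ 2) * Real.log (m * (l + 1) / δ)) / (γ ^ 2 * m)))) ∧
    -- how the main term for `τ ≠ 1` scales with `p = max ‖P_G‖₂`, the depth and the width
    (∀ w : Weights r d, w.Bounded M₁ M₂ → 0 < zeta w → τ ≠ 1 →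
      √((l : ℝ) ^ 2 * Psi0 l h B ε * Psi2 ξ w) ≤
        (B + ε) * √(normSq w) *
          max (zeta w)⁻¹
            ((L * M₁ * M₂ * (l - 1) * max 1 ((L : ℝ) ^ 3 * M₂) ^ (l - 2)) ^ (1 / (l : ℝ)))
              ^ (l + 1) *
          (max 1 p ^ (((l : ℝ) - 2) * (l + 1) / l) * l * √(h * Real.log (l * h)))) := by
  refine ⟨300, by norm_num, ?_⟩
  rintro n r d _ h hr rfl hd hK B 𝒳 𝒢 P h𝒳 hPbdd L act hact M₁ M₂ p τ ξ ε γ δ rfl rfl rfl hε hγ hδ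
    D _ hD m hm
  -- A probability measure has a point in its almost sure set; this yields `𝒢` nonempty, `p ≥ 0` and
  -- `B ≥ 0`.
  obtain ⟨z₀, hz₀⟩ := hD.exists
  have h𝒢 : 𝒢.Nonempty := ⟨_, hz₀.2⟩
  have hP : ∀ A ∈ 𝒢, specNorm (P A) ≤ maxSpec 𝒢 P := by
    intro A hA
    refine le_ciSup (f := fun A : 𝒢 => specNorm (P A)) ?_ ⟨A, hA⟩
    rwa [Set.image_eq_range] at hPbdd
  have hp : 0 ≤ maxSpec 𝒢 P := (specNorm_nonneg _).trans (hP _ hz₀.2)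
  have hB0 : 0 ≤ B := (specNorm_nonneg _).trans (h𝒳 _ hz₀.1)
  have hB : ∀ᵐ z ∂D, specNorm z.1.1 ≤ B := hD.mono fun z hz => h𝒳 _ hz.1
  have hh : 2 ≤ h := hK.trans (hd (r + 1) le_rfl)
  have hL : (0 : ℝ) ≤ L := L.coe_nonneg
  have hMpos : ∀ w : Weights r d, w.Bounded M₁ M₂ → 0 < zeta w → 0 < M₁ ∧ 0 < M₂ :=
    fun w hw hζ => ⟨hζ.trans_le ((zeta_le_U w ⟨0, hr⟩).trans (hw.2 ⟨0, hr⟩)),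
      hζ.trans_le ((zeta_le_W w 0).trans (hw.1 0))⟩
  constructor
  swap
  · intro w hw hζ hτ
    obtain ⟨hM₁, hM₂⟩ := hMpos w hw hζ
    rw [xi_eq r _ _ _ hτ]
    exact sqrt_main_term_le hr hh hL hM₁.le hM₂.le hp (by linarith) hζ
  rcases le_or_gt 1 δ with hδ1 | hδ1
  · exact ⟨∅, MeasurableSet.empty, by simpa using hδ1, fun S hS => absurd hS (Set.notMem_empty S)⟩
  -- Without such a network the claim is vacuous; with one, `M₁` and `M₂` are positive, as the
  -- covering argument requires.
  by_cases hex : ∃ w : Weights r d, w.Bounded M₁ M₂ ∧ 0 < zeta w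
  swap
  · exact ⟨Set.univ, MeasurableSet.univ, by simpa using hδ.le,
      fun S _ w hw hζ => absurd ⟨w, hw, hζ⟩ hex⟩
  obtain ⟨w₀, hw₀, hζ₀⟩ := hex
  obtain ⟨hM₁, hM₂⟩ := hMpos w₀ hw₀ hζ₀
  obtain ⟨E, hE, hEmass, hbound⟩ := exists_generalization_event hr hd hact hM₁ hM₂ hK hP hε h𝒢
    hB0 hB hγ hδ hδ1 hm
  have hm1 : (1 : ℝ) ≤ m := by exact_mod_cast hm
  have hτ0 := tau_nonneg (L := L) hM₂.le hp
  -- The proof only produces `log (1 / δ)`; the factors `m` and `l + 1` in the stated logarithms are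
  -- slack.
  have hlog1 : Real.log (1 / δ) ≤ Real.log (m / δ) :=
    Real.log_le_log (by positivity) (by gcongr)
  have hlog2 : Real.log (1 / δ) ≤ Real.log (m * (((r + 1 : ℕ) : ℝ) + 1) / δ) := by
    refine hlog1.trans (Real.log_le_log (by positivity) ?_)
    gcongr
    exact le_mul_of_one_le_right (by positivity) (le_add_of_nonneg_left (Nat.cast_nonneg _))
  have hγ1 : 0 ≤ max 1 (γ ^ 2) := by positivity
  refine ⟨E, hE, hEmass, fun S hS w hw hζ => ⟨fun hτ => ?_, fun hτ => ?_⟩⟩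
  · refine (hbound S hS w hw hζ).trans ?_
    rw [hτ]
    have hc := complexity_le_Psi1 hr hh (by positivity : 0 ≤ (L : ℝ) * M₁ * M₂) B ε hζ
    gcongr
  · refine (hbound S hS w hw hζ).trans ?_
    rw [xi_eq r _ _ _ hτ]
    have hg := geo_nonneg hτ0 r
    have hc := complexity_le_Psi2 hr hh
      (by positivity : 0 ≤ (L : ℝ) * M₁ * M₂ * geo (tau L M₂ (maxSpec 𝒢 P)) r) B ε hζ
    gcongr
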